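/- Let $\mathbb F_q$ be a finite field, $\sigma\neq 1$ an automorphism of $\mathbb F_q$ with fixed field $\mathbb F_s$, and $V=\mathbb F_q^{\,n+1}$ (column vectors), with dual $V^*$ (row vectors); $x^\sigma$ denotes the vector obtained by applying $\sigma$ to all coordinates of $x$. Let $\bar\Gamma$ be the point-hyperplane geometry of $\mathrm{PG}(V)$: its points are the pairs $([x],[\xi])$ with $[x]\in\mathrm{PG}(V)$, $[\xi]\in\mathrm{PG}(V^*)$, $\xi x=0$; its lines are the sets $\{(p,H):p\in r\}$ for a line $r$ of $\mathrm{PG}(V)$ contained in the hyperplane $H$, and the sets $\{(p,H): S\subseteq H\}$ for a point $p$ and a subspace $S\ni p$ of codimension $2$. The twisted embedding is $\bar\varepsilon_\sigma([x],[\xi])=[x^\sigma\otimes\xi]=[x^\sigma\xi]\in \mathrm{PG}(M_{n+1}(q))$, and $\Lambda_\sigma=\bar\varepsilon_\sigma(\bar\Gamma)=\{[X_1],\dots,[X_N]\}$. Let $\mathcal C(\Lambda_\sigma)\subseteq\mathbb F_q^N$ be the linear code of all words $c_M=(\mathrm{Tr}(X_1M),\dots,\mathrm{Tr}(X_NM))$,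 $M\in M_{n+1}(q)$; the choice of the representatives $X_i$ is arbitrary. For $M\ne0$ let $\mathcal H_{M,\sigma}=\bar\varepsilon_\sigma^{-1}([M^\perp])$, where $M^\perp=\{X:\mathrm{Tr}(XM)=0\}$, be the hyperplane of $\bar\Gamma$ associated with $M$ (and with $c_M$). For a point $p$ and a hyperplane $A$ of $\mathrm{PG}(V)$, the quasi-singular hyperplane $\mathcal H_{p,A}$ of $\bar\Gamma$ is the set of all points of $\bar\Gamma$ collinear with a point of the form $(p,H)$ or $(x,A)$ of $\bar\Gamma$; it is called singular if $p\in A$. A hyperplane of semi-standard spread type is a set $\mathcal H_\phi=\{([x],[\xi])\in\bar\Gamma : \phi([x])\in[\xi]\}$, where $\phi$ is a fixed-point-free involutory collineation of $\mathrm{PG}(V)$ induced by a semilinear, non-linear bijection of $V$. Minimum and second lowest weights refer to non-zero codewords. Then: (1) If $n\ge2$, the code $\mathcal C(\Lambda_\sigma)$ is minimal: if $c,c'\in\mathcal C(\Lambda_\sigma)$ and $\mathrm{supp}(c')\subseteq\mathrm{supp}(c)$, then $c'=\lambda c$ for some $\lambda\in\mathbb F_q$. (2) If $n=2$ and $\sigma^2=1$,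 then $q=s^2$, the minimum weight of $\mathcal C(\Lambda_\sigma)$ is $q^3-\sqrt q^{\,3}$, and for $M\neq0$ the word $c_M$ is a minimum weight codeword if and only if there are linearly independent $\xi_1,\xi_2,\xi_3\in V^*$ and $\alpha_1,\alpha_2,\alpha_3\in\mathbb F_q\setminus\{0\}$ with $\xi_iM=\alpha_i\xi_i^\sigma$ for $i=1,2,3$ and $N(\alpha_1)=N(\alpha_2)=N(\alpha_3)$, where $N(a)=a^{s+1}$. (3) If $n>2$, or $n=2$ and $\sigma^2\ne1$, then the minimum weight of $\mathcal C(\Lambda_\sigma)$ is $q^{2n-1}-q^{n-1}$ and the second lowest weight is $q^{2n-1}$. For $M\ne0$, the word $c_M$ is a minimum weight codeword if and only if $\mathcal H_{M,\sigma}$ is quasi-singular but not singular, and it is a second lowest weight codeword if and only if $\mathcal H_{M,\sigma}$ is singular. Moreover every quasi-singular hyperplane of $\bar\Gamma$ is of the form $\mathcal H_{M,\sigma}$ with $M\neq 0$. (4) If $q$ and $n$ are both odd, then the maximum weight of $\mathcal C(\Lambda_\sigma)$ is $q^{n-1}(q^{n+1}-1)/(q-1)$. For all $q$ and $n$, if a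 hyperplane $\mathcal H$ of semi-standard spread type equals $\mathcal H_{M,\sigma}$ with $M\neq0$, then $\sigma^2=1$, $n$ is odd, and $c_M$ is a maximum weight codeword, of weight $q^{n-1}(q^{n+1}-1)/(q-1)$; and if $\sigma^2=1$, then every hyperplane of semi-standard spread type is of the form $\mathcal H_{M,\sigma}$ with $M\ne0$. -/

import Mathlib

open scoped LinearAlgebra.Projectivization Matrix

namespace TwistedCode

noncomputable section

/-! ### Linear codes -/

/-- The Hamming weight of a word: the number of its non-zero components. -/
def weight {F ι : Type*} [Zero F] (c : ι → F) : ℕ := (Function.support c).ncard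

/-- A code is minimal if, for every codeword `c`, each codeword whose support is contained in the
support of `c` is a scalar multiple of `c`. -/
def IsMinimalCode {F ι : Type*} [Field F] (C : Submodule F (ι → F)) : Prop :=
  ∀ c ∈ C, ∀ c' ∈ C, Function.support c' ⊆ Function.support c → ∃ a : F, c' = a • c

/-- The set of the weights of the non-zero codewords. -/
def weights {F ι : Type*} [Field F] (C : Submodule F (ι → F)) : Set ℕ :=
  {w | ∃ c ∈ C, c ≠ 0 ∧ weight c = w}

/-- The weights of non-zero codewords that are not the lowest one. -/
def nonMinimumWeights {F ι : Type*} [Field F] (C : Submodule F (ι → F)) : Set ℕ :=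
  {w | w ∈ weights C ∧ ∃ v ∈ weights C, v < w}

/-- `c` is a minimum weight codeword of `C`. -/
def IsMinimumWeightCodeword {F ι : Type*} [Field F] (C : Submodule F (ι → F)) (c : ι → F) : Prop :=
  c ∈ C ∧ c ≠ 0 ∧ IsLeast (weights C) (weight c)

/-- `c` is a second lowest weight codeword of `C`. -/
def IsSecondLowestWeightCodeword {F ι : Type*} [Field F] (C : Submodule F (ι → F))
    (c : ι → F) : Prop :=
  c ∈ C ∧ c ≠ 0 ∧ IsLeast (nonMinimumWeights C) (weight c)

/-- `c` is a maximum weight codeword of `C`. -/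
def IsMaximumWeightCodeword {F ι : Type*} [Field F] (C : Submodule F (ι → F)) (c : ι → F) : Prop :=
  c ∈ C ∧ c ≠ 0 ∧ IsGreatest (weights C) (weight c)

/-- `X` chooses a vector representative of each point of the set `Ω` of projective points. -/
def IsRepresentatives {F W : Type*} [Field F] [AddCommGroup W] [Module F W] {Ω : Set (ℙ F W)}
    (X : Ω → W) : Prop :=
  ∀ p : Ω, ∃ h : X p ≠ 0, Projectivization.mk F (X p) h = (p : ℙ F W)

/-- The code of a set `Ω` of projective points with vector representatives `X`: its codewords are
the families of values at the representatives of the linear functionals on the space, that is, it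
is generated by the rows of the matrix whose columns are the `X p`. -/
def projectiveCode {F W : Type*} [Field F] [AddCommGroup W] [Module F W] {Ω : Set (ℙ F W)}
    (X : Ω → W) : Submodule F (Ω → F) :=
  LinearMap.range (LinearMap.pi fun p : Ω => Module.Dual.eval F W (X p))

/-! ### The point-hyperplane geometry of `PG(n, F)`

Points are represented by (column) vectors and hyperplanes by (row) vectors, that is, by
functionals, both in coordinates. -/

/-- The points of the projective space `PG(V)`, `V = F ^ (n + 1)`. -/
abbrev PG (F : Type*) [Field F] (n : ℕ) : Type _ := ℙ F (Fin (n + 1) → F)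

/-- The points of `PG(V*)`, that is, the hyperplanes of `PG(V)`, as classes of row vectors. -/
abbrev DualPG (F : Type*) [Field F] (n : ℕ) : Type _ := ℙ F (Fin (n + 1) → F)

variable {F : Type*} [Field F] {n : ℕ}

/-- The point `p` lies on the hyperplane `H`: `ξ(x) = 0` for `p = [x]`, `H = [ξ]`. -/
def Incident (p : PG F n) (H : DualPG F n) : Prop := Projectivization.orthogonal H p

/-- The hyperplane of `V` defined by a point `[ξ]` of `PG(V*)`, i.e. the kernel of `ξ`. -/
def hyperplane (H : DualPG F n) : Submodule F (Fin (n + 1) → F) :=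
  LinearMap.ker (dotProductBilin F F H.rep)

/-- The points of the point-hyperplane geometry: incident point-hyperplane pairs. -/
structure PHPoint (F : Type*) [Field F] (n : ℕ) where
  pt : PG F n
  hyp : DualPG F n
  incident : Incident pt hyp

/-- The lines of the point-hyperplane geometry: the sets `{(p, H) : p ∈ r}` for a line `r` of
`PG(V)` contained in the hyperplane `H`, and the sets `{(p, H) : S ⊆ H}` for a point `p` and a
subspace `S` of codimension `2` of `PG(V)` with `p ∈ S`. -/
def IsLine (l : Set (PHPoint F n)) : Prop :=
  (∃ (r : Submodule F (Fin (n + 1) → F)) (H : DualPG F n),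
    Module.finrank F r = 2 ∧ r ≤ hyperplane H ∧ l = {P | P.hyp = H ∧ P.pt.submodule ≤ r}) ∨
  (∃ (p : PG F n) (S : Submodule F (Fin (n + 1) → F)),
    Module.finrank F S + 2 = n + 1 ∧ p.submodule ≤ S ∧
      l = {P | P.pt = p ∧ S ≤ hyperplane P.hyp})

/-- Two points of the point-hyperplane geometry are collinear if some line contains both. -/
def Collinear (P Q : PHPoint F n) : Prop := ∃ l, IsLine l ∧ P ∈ l ∧ Q ∈ l

/-- The set `H_{p,A}` of all points collinear with a point `(p, H)` or with a point `(x, A)`. -/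
def quasiSingular (p : PG F n) (A : DualPG F n) : Set (PHPoint F n) :=
  {P | ∃ Q : PHPoint F n, (Q.pt = p ∨ Q.hyp = A) ∧ Collinear P Q}

def IsQuasiSingular (H : Set (PHPoint F n)) : Prop :=
  ∃ (p : PG F n) (A : DualPG F n), H = quasiSingular p A

def IsSingular (H : Set (PHPoint F n)) : Prop :=
  ∃ (p : PG F n) (A : DualPG F n), Incident p A ∧ H = quasiSingular p A

/-- Hyperplanes of semi-standard spread type: the sets `{(x, H) : x, φ(x) ∈ H}`, where `φ` is a
non-linear (that is, with non-trivial companion automorphism `τ`) fixed-point-free involutory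
collineation of `PG(V)`. -/
def IsSemiStandardSpreadType (H : Set (PHPoint F n)) : Prop :=
  ∃ (τ : F ≃+* F) (f : (Fin (n + 1) → F) →ₛₗ[(τ : F →+* F)] (Fin (n + 1) → F))
    (hf : Function.Injective f),
    τ ≠ 1 ∧
    (∀ p : PG F n, Projectivization.map f hf (Projectivization.map f hf p) = p) ∧
    (∀ p : PG F n, Projectivization.map f hf p ≠ p) ∧
    H = {P | Incident (Projectivization.map f hf P.pt) P.hyp}

/-! ### The twisted embedding -/

/-- The matrix `x^σ ξ`, representing the pure tensor `x^σ ⊗ ξ`. -/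
def twistedTensor (σ : F ≃+* F) (x ξ : Fin (n + 1) → F) : Matrix (Fin (n + 1)) (Fin (n + 1)) F :=
  Matrix.vecMulVec (fun i => σ (x i)) ξ

theorem twistedTensor_ne_zero (σ : F ≃+* F) {x ξ : Fin (n + 1) → F} (hx : x ≠ 0) (hξ : ξ ≠ 0) :
    twistedTensor σ x ξ ≠ 0 := by
  obtain ⟨i, hi⟩ := Function.ne_iff.1 hx
  obtain ⟨j, hj⟩ := Function.ne_iff.1 hξ
  intro h
  have := congrFun (congrFun h i) j
  simp only [twistedTensor, Matrix.vecMulVec_apply, Matrix.zero_apply, mul_eq_zero] at this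
  simp only [EmbeddingLike.map_eq_zero_iff] at this
  exact this.elim hi hj

/-- The twisted embedding `([x], [ξ]) ↦ [x^σ ⊗ ξ]`. -/
def twistedEmbedding (σ : F ≃+* F) (P : PHPoint F n) :
    ℙ F (Matrix (Fin (n + 1)) (Fin (n + 1)) F) :=
  Projectivization.mk F (twistedTensor σ P.pt.rep P.hyp.rep)
    (twistedTensor_ne_zero σ P.pt.rep_nonzero P.hyp.rep_nonzero)

/-- The twisted embedding does not depend on the representatives. -/
theorem twistedEmbedding_mk (σ : F ≃+* F) {x ξ : Fin (n + 1) → F} (hx : x ≠ 0) (hξ : ξ ≠ 0)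
    (h : Incident (Projectivization.mk F x hx) (Projectivization.mk F ξ hξ)) :
    twistedEmbedding σ ⟨Projectivization.mk F x hx, Projectivization.mk F ξ hξ, h⟩ =
      Projectivization.mk F (twistedTensor σ x ξ) (twistedTensor_ne_zero σ hx hξ) := by
  obtain ⟨a, ha⟩ := Projectivization.exists_smul_eq_mk_rep F x hx
  obtain ⟨b, hb⟩ := Projectivization.exists_smul_eq_mk_rep F ξ hξ
  rw [twistedEmbedding, Projectivization.mk_eq_mk_iff']
  refine ⟨σ a * b, ?_⟩
  ext i j
  simp only [twistedTensor, ← ha, ← hb, Matrix.smul_apply, Matrix.vecMulVec_apply, Pi.smul_apply,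
    Units.smul_def, smul_eq_mul, map_mul]
  ring

/-- The projective system `Λ_σ`, the image of the twisted embedding. -/
def projectiveSystem (n : ℕ) (σ : F ≃+* F) : Set (ℙ F (Matrix (Fin (n + 1)) (Fin (n + 1)) F)) :=
  Set.range (twistedEmbedding (n := n) σ)

/-- `M^⊥`, the orthogonal space of `M` for the form `(X, Y) ↦ Tr(X Y)`. -/
def perp (M : Matrix (Fin (n + 1)) (Fin (n + 1)) F) :
    Submodule F (Matrix (Fin (n + 1)) (Fin (n + 1)) F) :=
  LinearMap.ker (Matrix.traceLinearMap (Fin (n + 1)) F F ∘ₗ LinearMap.mulRight F M)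

/-- The hyperplane of the point-hyperplane geometry arising from `M^⊥` via the twisted embedding,
that is, the preimage of `[M^⊥]`. -/
def arisingHyperplane (σ : F ≃+* F) (M : Matrix (Fin (n + 1)) (Fin (n + 1)) F) :
    Set (PHPoint F n) :=
  {P | (twistedEmbedding σ P).submodule ≤ perp M}

/-- The codeword `c_M`, with components `Tr(X_i M)`. -/
def codeword {Ω : Set (ℙ F (Matrix (Fin (n + 1)) (Fin (n + 1)) F))}
    (X : Ω → Matrix (Fin (n + 1)) (Fin (n + 1)) F) (M : Matrix (Fin (n + 1)) (Fin (n + 1)) F) :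
    Ω → F :=
  fun p => Matrix.trace (X p * M)

end

end TwistedCode

/-! The word `c_M` is governed by the `σ`-semilinear map `f : x ↦ M x^σ`: the hyperplane of `M`
consists of the `([x], [ξ])` with `ξ (f x) = 0`. Over a point `[x]` fixed by `f`, or with
`f x = 0`, every hyperplane through `[x]` qualifies; over any other point the condition cuts the
hyperplanes down to those through the line `⟨x, f x⟩`. So `c_M` has weight `q ^ (n - 1)` times the
number of points that are not eigenpoints of `f`, and the weights are read off from the possible
sets of eigenpoints.

On a line spanned by two eigenpoints with eigenvalues `d`, `a ≠ 0`, the eigenpoints `[x + u y]`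
satisfy `a σ(u) = d u`, so they form a subline over the fixed field as soon as there is a third
one. Adding independent eigenvectors one at a time bounds the number of eigenpoints outside the
kernel by that of a subgeometry over `F_s`. Hence the maps of rank one, whose hyperplanes are the
quasi-singular ones, have the most eigenpoints, except in the plane with `q = s ^ 2`, where a Baer
subplane beats them. The absence of eigenpoints gives the maximum weight.

If the support of `c_M'` lies in that of `c_M`, then `g x ∈ ⟨x, f x⟩` for all `x`, where `g`
belongs to `M'`; as `σ ≠ 1` and the dimension is at least three, this forces `g` to be a multiple
of `f`.

Over a finite field there are no semi-standard spreads at all. If `f` is semilinear and `f ^ 2`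
acts trivially on the points, then `f ^ 2` is a scalar of the fixed field, hence a norm, and a
multiple of `f` is an involution `g`; unless `x` is itself fixed up to a scalar, so is `x + g x`.
-/

namespace TwistedCode

/-! ### Automorphisms of finite fields -/

section FixedField

variable {F : Type*} [Field F]

/-- The subfield `F_s` of the elements fixed by an endomorphism `σ` of the field `F`. -/
def fixedField (σ : F →+* F) : Subfield F := RingHom.eqLocusField σ (RingHom.id F)

theorem mem_fixedField {σ : F →+* F} {a : F} : a ∈ fixedField σ ↔ σ a = a := Iff.rfl

theorem fixedField_eq_fixedPoints (σ : F ≃+* F) :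
    fixedField (σ : F →+* F) = FixedPoints.subfield (Subgroup.zpowers σ) F := by
  ext a
  refine ⟨?_, fun h => h ⟨σ, Subgroup.mem_zpowers σ⟩⟩
  rintro h ⟨g, hg⟩
  have hle : Subgroup.zpowers σ ≤ MulAction.stabilizer (F ≃+* F) a := Subgroup.zpowers_le.2 h
  exact hle hg

theorem coe_ne_id {σ : F ≃+* F} (hσ : σ ≠ 1) : (σ : F →+* F) ≠ RingHom.id F := fun h =>
  hσ (RingEquiv.ext (RingHom.congr_fun h))

theorem apply_apply_of_sq_eq_one {σ : F ≃+* F} (hσ2 : σ ^ 2 = 1) (x : F) : σ (σ x) = x := by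
  rw [← RingAut.mul_apply, ← pow_two, hσ2, RingAut.one_apply]

/-- Hilbert's Theorem 90 for an involution. -/
theorem exists_ne_zero_mul_apply_eq {σ : F ≃+* F} (hσ : σ ≠ 1) (hσ2 : σ ^ 2 = 1) {c : F}
    (hc : c * σ c = 1) : ∃ a : F, a ≠ 0 ∧ c * σ a = a := by
  have hfix : ∀ b, c * σ (b + c * σ b) = b + c * σ b := fun b => by
    rw [map_add, map_mul, apply_apply_of_sq_eq_one hσ2]
    linear_combination b * hc
  by_contra! h
  have hzero : ∀ b, b + c * σ b = 0 := fun b => by_contra fun hb => h _ hb (hfix b)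
  have hc1 : c = -1 := by
    have h1 := hzero 1
    rw [map_one] at h1
    linear_combination h1
  refine hσ (RingEquiv.ext fun b => ?_)
  have hb := hzero b
  rw [hc1] at hb
  rw [RingAut.one_apply]
  linear_combination -hb

variable [Finite F]

theorem two_le_card_fixedField (σ : F →+* F) : 2 ≤ Nat.card (fixedField σ) :=
  Finite.one_lt_card

theorem finrank_fixedField (σ : F ≃+* F) :
    Module.finrank (fixedField (σ : F →+* F)) F = orderOf σ := by
  have : Finite (F ≃+* F) := Finite.of_injective _ (DFunLike.coe_injective (F := F ≃+* F))
  have := Fintype.ofFinite (Subgroup.zpowers σ)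
  rw [fixedField_eq_fixedPoints, ← Nat.card_zpowers, Nat.card_eq_fintype_card]
  exact FixedPoints.finrank_eq_card (Subgroup.zpowers σ) F

theorem card_eq_card_fixedField_pow_orderOf (σ : F ≃+* F) :
    Nat.card F = Nat.card (fixedField (σ : F →+* F)) ^ orderOf σ := by
  rw [← finrank_fixedField]
  exact Module.natCard_eq_pow_finrank

theorem two_le_orderOf {σ : F ≃+* F} (hσ : σ ≠ 1) : 2 ≤ orderOf σ := by
  have : Finite (F ≃+* F) := Finite.of_injective _ (DFunLike.coe_injective (F := F ≃+* F))
  have hpos := orderOf_pos σ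
  have hne : orderOf σ ≠ 1 := mt orderOf_eq_one_iff.1 hσ
  omega

theorem three_le_orderOf {σ : F ≃+* F} (hσ : σ ≠ 1) (hσ2 : σ ^ 2 ≠ 1) : 3 ≤ orderOf σ := by
  have hle := two_le_orderOf hσ
  have hne : orderOf σ ≠ 2 := fun h => hσ2 (h ▸ pow_orderOf_eq_one σ)
  omega

theorem card_fixedField_pow_le {σ : F ≃+* F} {k : ℕ} (hk : k ≤ orderOf σ) :
    Nat.card (fixedField (σ : F →+* F)) ^ k ≤ Nat.card F := by
  rw [card_eq_card_fixedField_pow_orderOf σ]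
  exact Nat.pow_le_pow_right Nat.card_pos hk

theorem card_eq_card_fixedField_sq {σ : F ≃+* F} (hσ : σ ≠ 1) (hσ2 : σ ^ 2 = 1) :
    Nat.card F = Nat.card (fixedField (σ : F →+* F)) ^ 2 := by
  rw [← orderOf_eq_prime hσ2 hσ]
  exact card_eq_card_fixedField_pow_orderOf σ

theorem four_le_card {σ : F ≃+* F} (hσ : σ ≠ 1) : 4 ≤ Nat.card F :=
  (Nat.pow_le_pow_left (two_le_card_fixedField (σ : F →+* F)) 2).trans
    (card_fixedField_pow_le (two_le_orderOf hσ))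

theorem apply_eq_pow_card_fixedField {σ : F ≃+* F} (hσ : σ ≠ 1) (hσ2 : σ ^ 2 = 1) (x : F) :
    σ x = x ^ Nat.card (fixedField (σ : F →+* F)) := by
  have := Fintype.ofFinite (fixedField (σ : F →+* F))
  let σ' : F ≃ₐ[fixedField (σ : F →+* F)] F := AlgEquiv.ofRingEquiv (f := σ) fun a => a.2
  obtain ⟨⟨i, hi⟩, h⟩ :=
    (FiniteField.bijective_frobeniusAlgEquivOfAlgebraic_pow (fixedField (σ : F →+* F)) F).2 σ'
  rw [finrank_fixedField, orderOf_eq_prime hσ2 hσ] at hi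
  have hx := fun y : F => DFunLike.congr_fun h y
  interval_cases i
  · exact absurd (RingEquiv.ext fun y => (hx y).symm) hσ
  · rw [Nat.card_eq_fintype_card]
    simpa using! (hx x).symm

theorem pow_card_fixedField_succ {σ : F ≃+* F} (hσ : σ ≠ 1) (hσ2 : σ ^ 2 = 1) (x : F) :
    x ^ (Nat.card (fixedField (σ : F →+* F)) + 1) = x * σ x := by
  rw [pow_succ', apply_eq_pow_card_fixedField hσ hσ2]

theorem exists_mul_apply_eq {σ : F ≃+* F} (hσ : σ ≠ 1) (hσ2 : σ ^ 2 = 1) {c : F}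
    (hc : σ c = c) : ∃ a : F, a * σ a = c := by
  obtain ⟨a, ha⟩ := FiniteField.norm_surjective (fixedField (σ : F →+* F)) F ⟨c, hc⟩
  refine ⟨a, ?_⟩
  have h := congrArg (algebraMap (fixedField (σ : F →+* F)) F) ha
  rw [FiniteField.algebraMap_norm_eq_pow, card_eq_card_fixedField_sq hσ hσ2] at h
  have hdiv : (Nat.card (fixedField (σ : F →+* F)) ^ 2 - 1) /
      (Nat.card (fixedField (σ : F →+* F)) - 1) = Nat.card (fixedField (σ : F →+* F)) + 1 := by
    have h2 := two_le_card_fixedField (σ : F →+* F)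
    refine Nat.div_eq_of_eq_mul_left (by omega) ?_
    simpa using Nat.sq_sub_sq (Nat.card (fixedField (σ : F →+* F))) 1
  rw [hdiv, pow_card_fixedField_succ hσ hσ2] at h
  exact h

end FixedField

/-! ### Eigenpoints of semilinear maps -/

section ProjectiveCounting

variable {F V : Type*} [Field F] [AddCommGroup V] [Module F V]

theorem submodule_le_iff_rep_mem {p : ℙ F V} {U : Submodule F V} :
    p.submodule ≤ U ↔ p.rep ∈ U := by
  rw [Projectivization.submodule_eq, Submodule.span_singleton_le_iff_mem]

theorem exists_eq_mk_add {W : Submodule F V} {y : V} {p : ℙ F V} (hp : p.submodule ≤ W ⊔ F ∙ y)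
    (hpW : ¬ p.submodule ≤ W) : ∃ w ∈ W, ∃ h : y + w ≠ 0, p = Projectivization.mk F (y + w) h := by
  rw [submodule_le_iff_rep_mem] at hp hpW
  obtain ⟨w, hw, z, hz, hsum⟩ := Submodule.mem_sup.1 hp
  obtain ⟨b, rfl⟩ := Submodule.mem_span_singleton.1 hz
  have hb : b ≠ 0 := by
    rintro rfl
    rw [zero_smul, add_zero] at hsum
    exact hpW (hsum ▸ hw)
  have hrep : y + b⁻¹ • w = b⁻¹ • p.rep := by rw [← hsum, smul_add, inv_smul_smul₀ hb, add_comm]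
  refine ⟨b⁻¹ • w, W.smul_mem _ hw, ?_, ?_⟩
  · rw [hrep]
    exact smul_ne_zero (inv_ne_zero hb) p.rep_nonzero
  · exact p.mk_rep.symm.trans <| (Projectivization.mk_eq_mk_iff' F _ _ _ _).2
      ⟨b, by rw [hrep, smul_inv_smul₀ hb]⟩

theorem eq_of_smul_add_eq_smul_add {W : Submodule F V} {y : V} (hy : y ∉ W) {a b : F} {w w' : V}
    (hw : w ∈ W) (hw' : w' ∈ W) (h : a • y + w = b • y + w') : a = b := by
  by_contra hab
  refine hy ((Submodule.smul_mem_iff W (sub_ne_zero.2 hab)).1 ?_)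
  rw [sub_smul, sub_eq_sub_iff_add_eq_add.2 (h.trans (add_comm _ _))]
  exact W.sub_mem hw' hw

theorem ncard_submodule_le [Finite F] (U : Submodule F V) :
    {p : ℙ F V | p.submodule ≤ U}.ncard =
      ∑ i ∈ Finset.range (Module.finrank F U), Nat.card F ^ i := by
  have hrange : {p : ℙ F V | p.submodule ≤ U} =
      Set.range (Projectivization.map U.subtype U.injective_subtype) := by
    ext p
    induction p with | h v hv =>
    rw [Set.mem_ofPred_eq, Projectivization.submodule_mk, Submodule.span_singleton_le_iff_mem]
    constructor
    · intro h
      exact ⟨Projectivization.mk F ⟨v, h⟩ (fun h0 => hv (congrArg Subtype.val h0)), rfl⟩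
    · rintro ⟨w, hw⟩
      induction w with | h w hw0 =>
      rw [Projectivization.map_mk, Projectivization.mk_eq_mk_iff'] at hw
      obtain ⟨a, ha⟩ := hw
      have ha0 : a ≠ 0 := by
        rintro rfl
        exact hw0 (Subtype.ext (by simpa using ha.symm))
      rw [← inv_smul_smul₀ ha0 v, ha]
      exact U.smul_mem _ w.2
  rw [hrange, ← Set.image_univ, Set.ncard_image_of_injective _
    (Projectivization.map_injective U.subtype U.injective_subtype), Set.ncard_univ,
    Projectivization.card_of_finrank F U rfl]

theorem ncard_submodule_le_not_le_ker [Finite F] [FiniteDimensional F V] {U : Submodule F V}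
    {φ : Module.Dual F V} (hφ : ¬ U ≤ LinearMap.ker φ) :
    {p : ℙ F V | p.submodule ≤ U ∧ ¬ p.submodule ≤ LinearMap.ker φ}.ncard =
      Nat.card F ^ (Module.finrank F U - 1) := by
  have := Module.finite_of_finite F (M := V)
  have hne : φ.domRestrict U ≠ 0 := fun h => hφ fun x hx =>
    LinearMap.congr_fun h (⟨x, hx⟩ : U)
  have hmap : (LinearMap.ker (φ.domRestrict U)).map U.subtype = U ⊓ LinearMap.ker φ := by
    rw [LinearMap.domRestrict, LinearMap.ker_comp, Submodule.map_comap_subtype]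
  have hrank : Module.finrank F ↥(U ⊓ LinearMap.ker φ) + 1 = Module.finrank F U := by
    rw [← hmap, Submodule.finrank_map_subtype_eq, Module.Dual.finrank_ker_add_one_of_ne_zero hne]
  have hset : {p : ℙ F V | p.submodule ≤ U ∧ ¬ p.submodule ≤ LinearMap.ker φ} =
      {p : ℙ F V | p.submodule ≤ U} \ {p : ℙ F V | p.submodule ≤ U ⊓ LinearMap.ker φ} := by
    ext p
    simp only [Set.mem_ofPred_eq, Set.mem_sdiff, le_inf_iff]
    tauto
  have hsub : {p : ℙ F V | p.submodule ≤ U ⊓ LinearMap.ker φ} ⊆ {p : ℙ F V | p.submodule ≤ U} :=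
    fun p (hp : p.submodule ≤ U ⊓ LinearMap.ker φ) => hp.trans inf_le_left
  rw [hset, Set.ncard_sdiff hsub, ncard_submodule_le,
    ncard_submodule_le, ← hrank, Finset.sum_range_succ, Nat.add_sub_cancel_left,
    Nat.add_sub_cancel]

end ProjectiveCounting

section Rescalings

variable {F : Type*} [Field F] {σ : F →+* F} {c d : F}

/-- The scalars `a` such that, for a `σ`-semilinear map `f` and a vector `x` with `f x = d x`, the
multiple `a x` satisfies `f (a x) = c (a x)`. -/
def rescalings (σ : F →+* F) (d c : F) : Set F := {a | σ a * d = c * a}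

theorem mem_rescalings {a : F} : a ∈ rescalings σ d c ↔ σ a * d = c * a := Iff.rfl

theorem ncard_rescalings_of_mem (hc : c ≠ 0) (hd : d ≠ 0) {b : F} (hb0 : b ≠ 0)
    (hb : b ∈ rescalings σ d c) : (rescalings σ d c).ncard = Nat.card (fixedField σ) := by
  rw [mem_rescalings] at hb
  have himage : rescalings σ d c = (· * b) '' (fixedField σ : Set F) := by
    ext a
    simp only [mem_rescalings, Set.mem_image, SetLike.mem_coe, mem_fixedField]
    constructor
    · intro ha
      refine ⟨a / b, ?_, div_mul_cancel₀ a hb0⟩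
      rw [map_div₀, div_eq_div_iff (by simpa using hb0) hb0]
      apply mul_left_cancel₀ (mul_ne_zero hc hd)
      linear_combination (c * b) * ha - c * a * hb
    · rintro ⟨a, ha, rfl⟩
      rw [map_mul, ha]
      linear_combination a * hb
  rw [himage, Set.ncard_image_of_injective _ (mul_left_injective₀ hb0)]
  rfl

theorem ncard_rescalings_of_forall (h : ∀ a ∈ rescalings σ d c, a = 0) :
    (rescalings σ d c).ncard = 1 := by
  rw [Set.ncard_eq_one]
  refine ⟨0, Set.eq_singleton_iff_unique_mem.2 ⟨?_, h⟩⟩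
  rw [mem_rescalings, map_zero, zero_mul, mul_zero]

variable [Finite F]

theorem ncard_rescalings_pos : 0 < (rescalings σ d c).ncard :=
  (Set.ncard_pos).2 ⟨0, by rw [mem_rescalings, map_zero, zero_mul, mul_zero]⟩

theorem ncard_rescalings_le (hc : c ≠ 0) (hd : d ≠ 0) :
    (rescalings σ d c).ncard ≤ Nat.card (fixedField σ) := by
  by_cases! h : ∃ b ∈ rescalings σ d c, b ≠ 0
  · obtain ⟨b, hb, hb0⟩ := h
    exact (ncard_rescalings_of_mem hc hd hb0 hb).le
  · rw [ncard_rescalings_of_forall h]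
    exact Nat.card_pos

theorem ncard_rescalings_eq_card_iff (hc : c ≠ 0) (hd : d ≠ 0) :
    (rescalings σ d c).ncard = Nat.card (fixedField σ) ↔ ∃ a ≠ 0, σ a * d = c * a := by
  refine ⟨fun h => ?_, fun ⟨a, ha0, ha⟩ => ncard_rescalings_of_mem hc hd ha0 ha⟩
  by_contra! hall
  have hone := ncard_rescalings_of_forall fun a ha => by_contra fun ha0 => hall a ha0 ha
  have htwo := two_le_card_fixedField σ
  omega

end Rescalings

section SumProd

variable {r s : ℕ} {g : Fin r → Fin r → ℕ}

theorem sum_prod_Ioi_const (r s : ℕ) :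
    ∑ i : Fin r, ∏ _j ∈ Finset.Ioi i, s = ∑ i ∈ Finset.range r, s ^ i := by
  simp only [Finset.prod_const, Fin.card_Ioi]
  rw [← Finset.sum_range_reflect, Fin.sum_univ_eq_sum_range (fun i => s ^ (r - 1 - i))]

theorem sum_prod_Ioi_le (hle : ∀ i j, g i j ≤ s) :
    ∑ i, ∏ j ∈ Finset.Ioi i, g i j ≤ ∑ i ∈ Finset.range r, s ^ i := by
  rw [← sum_prod_Ioi_const]
  exact Finset.sum_le_sum fun i _ => Finset.prod_le_prod' fun j _ => hle i j

theorem sum_prod_Ioi_eq_iff (hpos : ∀ i j, 0 < g i j) (hle : ∀ i j, g i j ≤ s) :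
    ∑ i, ∏ j ∈ Finset.Ioi i, g i j = ∑ i ∈ Finset.range r, s ^ i ↔ ∀ i j, i < j → g i j = s := by
  rw [← sum_prod_Ioi_const,
    Finset.sum_eq_sum_iff_of_le fun i _ => Finset.prod_le_prod' fun j _ => hle i j]
  refine forall_congr' fun i => ⟨fun h j hij => ?_, fun h _ => Finset.prod_congr rfl fun j hj =>
    h j (Finset.mem_Ioi.1 hj)⟩
  by_contra hne
  exact (Finset.prod_lt_prod (fun j _ => hpos i j) (fun j _ => hle i j)
    ⟨j, Finset.mem_Ioi.2 hij, lt_of_le_of_ne (hle i j) hne⟩).ne (h (Finset.mem_univ i))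

end SumProd

section Eigenpoints

variable {F V : Type*} [Field F] [AddCommGroup V] [Module F V] {σ : F →+* F}

/-- The eigenpoints of a semilinear map: the projective points `[x]` such that `f x` is a multiple
of `x`, possibly zero. -/
def eigenpoints (f : V →ₛₗ[σ] V) : Set (ℙ F V) := {p | f p.rep ∈ p.submodule}

variable {f : V →ₛₗ[σ] V}

theorem mk_mem_eigenpoints {x : V} (hx : x ≠ 0) :
    Projectivization.mk F x hx ∈ eigenpoints f ↔ ∃ a : F, f x = a • x := by
  obtain ⟨c, hc⟩ := Projectivization.exists_smul_eq_mk_rep F x hx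
  rw [eigenpoints, Set.mem_ofPred_eq, ← hc, Projectivization.submodule_mk, Units.smul_def,
    map_smulₛₗ, Submodule.smul_mem_iff _ ((map_ne_zero σ).2 c.ne_zero),
    Submodule.mem_span_singleton]
  simp only [eq_comm]

theorem mem_eigenpoints {p : ℙ F V} : p ∈ eigenpoints f ↔ ∃ a : F, f p.rep = a • p.rep := by
  rw [← mk_mem_eigenpoints p.rep_nonzero, p.mk_rep]

theorem eq_zero_of_forall_exists_map_eq_smul (hσ : σ ≠ RingHom.id F)
    (hV : 2 ≤ Module.finrank F V) (h : ∀ x, ∃ a : F, f x = a • x) : f = 0 := by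
  by_contra hf
  obtain ⟨x, hx⟩ := DFunLike.ne_iff.1 hf
  obtain ⟨a, ha⟩ := h x
  have hx0 : x ≠ 0 := by
    rintro rfl
    exact hx (map_zero f)
  have ha0 : a ≠ 0 := by
    rintro rfl
    exact hx (ha.trans (zero_smul F x))
  obtain ⟨y, hxy⟩ := exists_linearIndependent_pair_of_one_lt_finrank hV hx0
  obtain ⟨b, hb⟩ := h y
  have hcoeff : ∀ c, σ c * a = b * c := fun c => by
    obtain ⟨d, hd⟩ := h (c • x + y)
    rw [map_add, map_smulₛₗ, ha, hb] at hd
    obtain ⟨hcd, hbd⟩ := LinearIndependent.pair_iff.1 hxy (σ c * a - d * c) (b - d) <| by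
      linear_combination (norm := module) hd
    rw [sub_eq_zero.1 hcd, sub_eq_zero.1 hbd]
  have hab : a = b := by simpa using hcoeff 1
  exact hσ <| RingHom.ext fun c => mul_right_cancel₀ ha0 <| by
    rw [hcoeff, ← hab, mul_comm, RingHom.id_apply]

theorem map_sum_smul_eq_smul_iff {ι : Type*} [Fintype ι] {x : ι → V} {l : ι → F}
    (hx : LinearIndependent F x) (hf : ∀ i, f (x i) = l i • x i) {a : ι → F} {c : F} :
    f (∑ i, a i • x i) = c • ∑ i, a i • x i ↔ ∀ i, a i ∈ rescalings σ (l i) c := by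
  have hsub : f (∑ i, a i • x i) - c • ∑ i, a i • x i = ∑ i, (σ (a i) * l i - c * a i) • x i := by
    simp only [map_sum, map_smulₛₗ, hf, Finset.smul_sum, sub_smul, mul_smul,
      Finset.sum_sub_distrib]
  rw [← sub_eq_zero, hsub]
  constructor
  · intro h i
    exact sub_eq_zero.1 (Fintype.linearIndependent_iff.1 hx _ h i)
  · intro h
    exact Finset.sum_eq_zero fun i _ => by rw [sub_eq_zero.2 (h i), zero_smul]

theorem ncard_span_map_eq_smul {ι : Type*} [Fintype ι] {x : ι → V} {l : ι → F}
    (hx : LinearIndependent F x) (hf : ∀ i, f (x i) = l i • x i) (c : F) :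
    {w ∈ (Submodule.span F (Set.range x) : Set V) | f w = c • w}.ncard =
      ∏ i, (rescalings σ (l i) c).ncard := by
  have himage : {w ∈ (Submodule.span F (Set.range x) : Set V) | f w = c • w} =
      Fintype.linearCombination F x '' Set.univ.pi fun i => rescalings σ (l i) c := by
    ext w
    simp only [Set.mem_image, Set.mem_univ_pi, ← map_sum_smul_eq_smul_iff hx hf,
      Fintype.linearCombination_apply, Set.mem_ofPred_eq, SetLike.mem_coe,
      Submodule.mem_span_range_iff_exists_fun]
    constructor
    · rintro ⟨⟨a, rfl⟩, hw⟩
      exact ⟨a, hw, rfl⟩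
    · rintro ⟨a, ha, rfl⟩
      exact ⟨⟨a, rfl⟩, ha⟩
  have hinj : Function.Injective (Fintype.linearCombination F x) :=
    linearIndependent_iff_injective_fintypeLinearCombination.1 hx
  rw [himage, Set.ncard_image_of_injective _ hinj,
    ← Nat.card_coe_set_eq, Nat.card_congr (Equiv.Set.univPi _), Nat.card_pi]
  rfl

theorem exists_map_add_eq_smul_iff {W : Submodule F V} (hW : W ≤ W.comap f) {y : V} (hy : y ∉ W)
    {c : F} (hfy : f y = c • y) {w : V} (hw : w ∈ W) :
    (∃ a : F, f (y + w) = a • (y + w)) ↔ f w = c • w := by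
  refine ⟨?_, fun h => ⟨c, by rw [map_add, hfy, h, smul_add]⟩⟩
  rintro ⟨a, ha⟩
  rw [map_add, hfy, smul_add] at ha
  obtain rfl := eq_of_smul_add_eq_smul_add hy (hW hw) (W.smul_mem a hw) ha
  exact add_left_cancel ha

theorem ncard_eigenpoints_le_sup_span_singleton [Finite V] {W : Submodule F V}
    (hW : W ≤ W.comap f) {y : V} (hy : y ∉ W) {c : F} (hfy : f y = c • y) :
    {p ∈ eigenpoints f | p.submodule ≤ W ⊔ F ∙ y}.ncard =
      {p ∈ eigenpoints f | p.submodule ≤ W}.ncard +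
        {w ∈ (W : Set V) | f w = c • w}.ncard := by
  have hne : ∀ w ∈ W, y + w ≠ 0 := fun w hw h =>
    hy (eq_neg_of_add_eq_zero_left h ▸ W.neg_mem hw)
  let g : {w ∈ (W : Set V) | f w = c • w} → ℙ F V := fun w =>
    Projectivization.mk F (y + w) (hne w w.2.1)
  have hg : Function.Injective g := by
    rintro ⟨w, hw, _⟩ ⟨w', hw', _⟩ h
    obtain ⟨a, ha⟩ := (Projectivization.mk_eq_mk_iff' F _ _ _ _).1 h
    have ha1 : a = 1 := eq_of_smul_add_eq_smul_add hy (W.smul_mem a hw') hw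
      (by rw [one_smul, ← ha, smul_add])
    rw [ha1, one_smul] at ha
    exact Subtype.ext (add_left_cancel ha).symm
  have hrange : {p ∈ eigenpoints f | p.submodule ≤ W ⊔ F ∙ y} =
      {p ∈ eigenpoints f | p.submodule ≤ W} ∪ Set.range g := by
    ext p
    constructor
    · rintro ⟨hp, hpW⟩
      refine or_iff_not_imp_left.2 fun hnot => ?_
      obtain ⟨w, hw, h0, rfl⟩ := exists_eq_mk_add hpW fun h => hnot ⟨hp, h⟩
      exact ⟨⟨w, hw, (exists_map_add_eq_smul_iff hW hy hfy hw).1 ((mk_mem_eigenpoints h0).1 hp)⟩,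
        rfl⟩
    · rintro (⟨hp, hpW⟩ | ⟨⟨w, hw, hfw⟩, rfl⟩)
      · exact ⟨hp, hpW.trans le_sup_left⟩
      · refine ⟨(mk_mem_eigenpoints _).2 ((exists_map_add_eq_smul_iff hW hy hfy hw).2 hfw), ?_⟩
        rw [Projectivization.submodule_mk, Submodule.span_singleton_le_iff_mem]
        exact add_mem (Submodule.mem_sup_right (Submodule.mem_span_singleton_self y))
          (Submodule.mem_sup_left hw)
  have hdisj : Disjoint {p ∈ eigenpoints f | p.submodule ≤ W} (Set.range g) := by
    rw [Set.disjoint_left]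
    rintro _ ⟨-, hpW⟩ ⟨⟨w, hw, _⟩, rfl⟩
    rw [Projectivization.submodule_mk, Submodule.span_singleton_le_iff_mem] at hpW
    exact hy ((Submodule.add_mem_iff_left W hw).1 hpW)
  rw [hrange, Set.ncard_union_eq hdisj, ← Set.image_univ, Set.ncard_image_of_injective _ hg,
    Set.ncard_univ, Nat.card_coe_set_eq]

theorem ncard_eigenpoints_le_span [Finite V] {r : ℕ} {x : Fin r → V} {l : Fin r → F}
    (hx : LinearIndependent F x) (hf : ∀ i, f (x i) = l i • x i) :
    {p ∈ eigenpoints f | p.submodule ≤ Submodule.span F (Set.range x)}.ncard =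
      ∑ i, ∏ j ∈ Finset.Ioi i, (rescalings σ (l j) (l i)).ncard := by
  induction r with
  | zero =>
    rw [Finset.univ_eq_empty, Finset.sum_empty, Set.ncard_eq_zero, Set.eq_empty_iff_forall_notMem]
    rintro p ⟨-, hp⟩
    rw [Set.range_eq_empty, Submodule.span_empty, submodule_le_iff_rep_mem, Submodule.mem_bot] at hp
    exact p.rep_nonzero hp
  | succ r ih =>
    have hx' : LinearIndependent F (Fin.tail x) := hx.comp _ (Fin.succ_injective r)
    have hf' : ∀ i, f (Fin.tail x i) = Fin.tail l i • Fin.tail x i := fun i => hf i.succ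
    have hW : Submodule.span F (Set.range (Fin.tail x)) ≤
        (Submodule.span F (Set.range (Fin.tail x))).comap f := by
      rw [Submodule.span_le, Set.range_subset_iff]
      intro i
      rw [SetLike.mem_coe, Submodule.mem_comap, hf']
      exact Submodule.smul_mem _ _ (Submodule.subset_span (Set.mem_range_self i))
    have hy : x 0 ∉ Submodule.span F (Set.range (Fin.tail x)) :=
      (linearIndependent_finSucc.1 hx).2
    have hspan : Submodule.span F (Set.range x) =
        Submodule.span F (Set.range (Fin.tail x)) ⊔ F ∙ x 0 := by
      rw [← Fin.cons_self_tail x, Fin.range_cons, Submodule.span_insert, sup_comm]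
      rfl
    rw [hspan, ncard_eigenpoints_le_sup_span_singleton hW hy (hf 0), ih hx' hf',
      ncard_span_map_eq_smul hx' hf', Fin.sum_univ_succ, Fin.prod_Ioi_zero, add_comm]
    simp only [Fin.prod_Ioi_succ, Fin.tail]

/-- `x` is a family of independent eigenvectors of the semilinear map `f`, with non-zero
eigenvalues `l`, whose span contains all the eigenvectors with a non-zero eigenvalue. -/
structure IsEigenbasis {r : ℕ} (f : V →ₛₗ[σ] V) (x : Fin r → V) (l : Fin r → F) : Prop where
  linearIndependent : LinearIndependent F x
  ne_zero : ∀ i, l i ≠ 0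
  map_eq_smul : ∀ i, f (x i) = l i • x i
  mem_span : ∀ (v : V) (a : F), a ≠ 0 → f v = a • v → v ∈ Submodule.span F (Set.range x)

theorem exists_isEigenbasis [FiniteDimensional F V] (f : V →ₛₗ[σ] V) :
    ∃ (r : ℕ) (x : Fin r → V) (l : Fin r → F), IsEigenbasis f x l := by
  obtain ⟨b, hbE, hspan, hb⟩ :=
    exists_linearIndependent F {v : V | ∃ a : F, a ≠ 0 ∧ f v = a • v}
  have := hb.finite
  let e := (Finite.equivFin b).symm
  have hrange : Set.range (fun i => (e i : V)) = b := by
    rw [Set.range_comp' Subtype.val e, e.range_eq_univ, Set.image_univ, Subtype.range_coe]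
  choose l hl hf using fun i => hbE (e i).2
  refine ⟨Nat.card b, fun i => e i, l, hb.comp e e.injective, hl, hf, fun v a ha hv => ?_⟩
  rw [hrange, hspan]
  exact Submodule.subset_span ⟨a, ha, hv⟩

namespace IsEigenbasis

variable {r : ℕ} {x : Fin r → V} {l : Fin r → F}

theorem disjoint_ker (h : IsEigenbasis f x l) :
    Disjoint (Submodule.span F (Set.range x)) (LinearMap.ker f) := by
  rw [Submodule.disjoint_def]
  intro v hv hk
  obtain ⟨a, rfl⟩ := (Submodule.mem_span_range_iff_exists_fun F).1 hv
  rw [LinearMap.mem_ker, ← zero_smul F (∑ i, a i • x i),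
    map_sum_smul_eq_smul_iff h.linearIndependent h.map_eq_smul] at hk
  refine Finset.sum_eq_zero fun i _ => ?_
  have hai : σ (a i) * l i = 0 := (hk i).trans (zero_mul _)
  rw [(map_eq_zero σ).1 ((mul_eq_zero_iff_right (h.ne_zero i)).1 hai), zero_smul]

theorem add_finrank_ker_le [FiniteDimensional F V] (h : IsEigenbasis f x l) :
    r + Module.finrank F (LinearMap.ker f) ≤ Module.finrank F V := by
  have hle := Submodule.finrank_add_finrank_le_of_disjoint h.disjoint_ker
  rwa [finrank_span_eq_card h.linearIndependent, Fintype.card_fin] at hle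

theorem ncard_eigenpoints [Finite F] [Finite V] (h : IsEigenbasis f x l) :
    (eigenpoints f).ncard =
      ∑ i ∈ Finset.range (Module.finrank F (LinearMap.ker f)), Nat.card F ^ i +
        ∑ i, ∏ j ∈ Finset.Ioi i, (rescalings σ (l j) (l i)).ncard := by
  have hunion : eigenpoints f = {p | p.submodule ≤ LinearMap.ker f} ∪
      {p ∈ eigenpoints f | p.submodule ≤ Submodule.span F (Set.range x)} := by
    ext p
    simp only [Set.mem_union, Set.mem_ofPred_eq, submodule_le_iff_rep_mem, LinearMap.mem_ker]
    refine ⟨fun hp => ?_, fun hp => hp.elim (fun h0 => ?_) And.left⟩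
    · obtain ⟨a, ha⟩ := mem_eigenpoints.1 hp
      rcases eq_or_ne a 0 with rfl | ha0
      · exact Or.inl (by rw [ha, zero_smul])
      · exact Or.inr ⟨hp, h.mem_span _ a ha0 ha⟩
    · exact mem_eigenpoints.2 ⟨0, by rw [h0, zero_smul]⟩
  have hdisj : Disjoint {p : ℙ F V | p.submodule ≤ LinearMap.ker f}
      {p ∈ eigenpoints f | p.submodule ≤ Submodule.span F (Set.range x)} := by
    rw [Set.disjoint_left]
    rintro p hker ⟨-, hspan⟩
    exact p.rep_nonzero (Submodule.disjoint_def.1 h.disjoint_ker _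
      (submodule_le_iff_rep_mem.1 hspan) (submodule_le_iff_rep_mem.1 hker))
  rw [hunion, Set.ncard_union_eq hdisj, ncard_submodule_le,
    ncard_eigenpoints_le_span h.linearIndependent h.map_eq_smul]

theorem ncard_eigenpoints_le [Finite F] [Finite V] (h : IsEigenbasis f x l) :
    (eigenpoints f).ncard ≤
      ∑ i ∈ Finset.range (Module.finrank F (LinearMap.ker f)), Nat.card F ^ i +
        ∑ i ∈ Finset.range r, Nat.card (fixedField σ) ^ i := by
  rw [h.ncard_eigenpoints]
  exact Nat.add_le_add_left
    (sum_prod_Ioi_le fun i j => ncard_rescalings_le (h.ne_zero i) (h.ne_zero j)) _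

end IsEigenbasis

theorem ncard_eigenpoints_le_sum_add_sum [Finite F] [Finite V] (f : V →ₛₗ[σ] V) :
    (eigenpoints f).ncard ≤
      ∑ i ∈ Finset.range (Module.finrank F (LinearMap.ker f)), Nat.card F ^ i +
        ∑ i ∈ Finset.range (Module.finrank F V - Module.finrank F (LinearMap.ker f)),
          Nat.card (fixedField σ) ^ i := by
  have := Module.Finite.of_finite (R := F) (M := V)
  obtain ⟨r, x, l, h⟩ := exists_isEigenbasis f
  exact h.ncard_eigenpoints_le.trans <| Nat.add_le_add_left (Finset.sum_le_sum_of_subset <|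
    Finset.range_mono <| Nat.le_sub_of_add_le h.add_finrank_ker_le) _

end Eigenpoints

/-! ### The weight formula -/

section TwistedMap

variable {F ι : Type*} [Field F] [Fintype ι]

theorem finrank_ker_dotProductBilin_add_one {b : ι → F} (hb : b ≠ 0) :
    Module.finrank F (LinearMap.ker (dotProductBilin F F b)) + 1 = Fintype.card ι := by
  have hne : dotProductBilin F F b ≠ 0 := fun h =>
    hb (dotProduct_eq_zero b fun x => LinearMap.congr_fun h x)
  rw [Module.Dual.finrank_ker_add_one_of_ne_zero hne, Module.finrank_fintype_fun_eq_card]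

theorem exists_dotProduct_ne_zero {U : Submodule F (ι → F)} {y : ι → F} (hy : y ∉ U) :
    ∃ ξ : ι → F, U ≤ LinearMap.ker (dotProductBilin F F ξ) ∧ ξ ⬝ᵥ y ≠ 0 := by
  classical
  obtain ⟨φ, hφ, hU⟩ := Submodule.exists_le_ker_of_notMem hy
  have hφ_apply : ∀ x, (dotProductEquiv F ι).symm φ ⬝ᵥ x = φ x := fun x =>
    LinearMap.congr_fun ((dotProductEquiv F ι).apply_symm_apply φ) x
  exact ⟨(dotProductEquiv F ι).symm φ, fun x hx => (hφ_apply x).trans (hU hx),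
    fun h => hφ ((hφ_apply y).symm.trans h)⟩

theorem ncard_hyperplanes_through_avoiding [Finite F] {x y : ι → F} (hx : x ≠ 0)
    (hy : y ∉ F ∙ x) :
    {H : ℙ F (ι → F) | H.rep ⬝ᵥ x = 0 ∧ H.rep ⬝ᵥ y ≠ 0}.ncard =
      Nat.card F ^ (Fintype.card ι - 2) := by
  obtain ⟨ξ, hξx, hξy⟩ := exists_dotProduct_ne_zero hy
  have hξ : x ⬝ᵥ ξ = 0 :=
    (dotProduct_comm x ξ).trans (hξx (Submodule.mem_span_singleton_self x))
  have hker : ¬ LinearMap.ker (dotProductBilin F F x) ≤ LinearMap.ker (dotProductBilin F F y) :=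
    fun h => hξy ((dotProduct_comm ξ y).trans (h hξ))
  rw [← finrank_ker_dotProductBilin_add_one hx, Nat.add_sub_add_right,
    ← ncard_submodule_le_not_le_ker hker]
  simp only [submodule_le_iff_rep_mem, LinearMap.mem_ker, dotProductBilin_apply_apply,
    dotProduct_comm x, dotProduct_comm y, ne_eq]

/-- The semilinear map `x ↦ M x^σ` attached to the codeword `c_M`. -/
def twistedMap (σ : F →+* F) (M : Matrix ι ι F) : (ι → F) →ₛₗ[σ] (ι → F) where
  toFun x := M *ᵥ (σ ∘ x)
  map_add' x y := by
    rw [← Matrix.mulVec_add]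
    exact congrArg _ (funext fun i => map_add σ (x i) (y i))
  map_smul' a x := by
    rw [← Matrix.mulVec_smul]
    exact congrArg _ (funext fun i => map_mul σ a (x i))

theorem twistedMap_apply (σ : F →+* F) (M : Matrix ι ι F) (x : ι → F) :
    twistedMap σ M x = M *ᵥ (σ ∘ x) := rfl

theorem twistedMap_injective (σ : F →+* F) :
    Function.Injective (twistedMap σ : Matrix ι ι F → _) := by
  classical
  intro M N h
  have hsingle : ∀ j : ι, σ ∘ (Pi.single j 1 : ι → F) = Pi.single j 1 := fun j =>
    funext fun i => (Pi.apply_single (fun _ => σ) (fun _ => map_zero σ) j 1 i).trans <| by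
      rw [map_one]
  refine Matrix.ext_of_mulVec_single fun j => ?_
  rw [← hsingle, ← twistedMap_apply, h, twistedMap_apply]

theorem twistedMap_zero (σ : F →+* F) : twistedMap σ (0 : Matrix ι ι F) = 0 :=
  LinearMap.ext fun _ => Matrix.zero_mulVec _

theorem twistedMap_ne_zero {σ : F →+* F} {M : Matrix ι ι F} (hM : M ≠ 0) : twistedMap σ M ≠ 0 :=
  fun h => hM (twistedMap_injective σ (h.trans (twistedMap_zero σ).symm))

end TwistedMap

section WeightFormula

variable {F : Type*} [Field F] {n : ℕ}

attribute [ext] PHPoint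

theorem incident_iff_rep {p : PG F n} {H : DualPG F n} :
    Incident p H ↔ H.rep ⬝ᵥ p.rep = 0 := by
  conv_lhs => rw [← p.mk_rep, ← H.mk_rep]
  exact Projectivization.orthogonal_mk _ _

theorem trace_twistedTensor_mul (σ : F ≃+* F) (M : Matrix (Fin (n + 1)) (Fin (n + 1)) F)
    (x ξ : Fin (n + 1) → F) :
    (twistedTensor σ x ξ * M).trace = ξ ⬝ᵥ twistedMap (σ : F →+* F) M x := by
  rw [twistedTensor, Matrix.trace_mul_comm, Matrix.mul_vecMulVec, Matrix.trace_vecMulVec,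
    dotProduct_comm]
  rfl

theorem mem_perp {M N : Matrix (Fin (n + 1)) (Fin (n + 1)) F} :
    N ∈ perp M ↔ (N * M).trace = 0 := Iff.rfl

theorem mem_arisingHyperplane {σ : F ≃+* F} {M : Matrix (Fin (n + 1)) (Fin (n + 1)) F}
    {P : PHPoint F n} :
    P ∈ arisingHyperplane σ M ↔ P.hyp.rep ⬝ᵥ twistedMap (σ : F →+* F) M P.pt.rep = 0 := by
  rw [arisingHyperplane, Set.mem_ofPred_eq, twistedEmbedding, Projectivization.submodule_mk,
    Submodule.span_singleton_le_iff_mem, mem_perp, trace_twistedTensor_mul]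

theorem mk_mem_arisingHyperplane {σ : F ≃+* F} {M : Matrix (Fin (n + 1)) (Fin (n + 1)) F}
    {x ξ : Fin (n + 1) → F} (hx : x ≠ 0) (hξ : ξ ≠ 0)
    (h : Incident (Projectivization.mk F x hx) (Projectivization.mk F ξ hξ)) :
    (⟨Projectivization.mk F x hx, Projectivization.mk F ξ hξ, h⟩ : PHPoint F n) ∈
      arisingHyperplane σ M ↔ ξ ⬝ᵥ twistedMap (σ : F →+* F) M x = 0 := by
  rw [arisingHyperplane, Set.mem_ofPred_eq, twistedEmbedding_mk, Projectivization.submodule_mk,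
    Submodule.span_singleton_le_iff_mem, mem_perp, trace_twistedTensor_mul]

theorem exists_eq_smul_of_vecMulVec_eq_smul {l m : Type*} {a a' : l → F} {b b' : m → F} {c : F}
    (ha : a ≠ 0) (hb : b ≠ 0) (h : Matrix.vecMulVec a b = c • Matrix.vecMulVec a' b') :
    (∃ r : F, a = r • a') ∧ ∃ r : F, b = r • b' := by
  have hentry : ∀ i j, a i * b j = c * (a' i * b' j) := fun i j => congrFun (congrFun h i) j
  obtain ⟨i, hi : a i ≠ 0⟩ := Function.ne_iff.1 ha
  obtain ⟨j, hj : b j ≠ 0⟩ := Function.ne_iff.1 hb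
  refine ⟨⟨c * b' j / b j, funext fun k => ?_⟩, ⟨c * a' i / a i, funext fun k => ?_⟩⟩
  · rw [Pi.smul_apply, smul_eq_mul, div_mul_eq_mul_div, eq_div_iff hj, hentry]
    ring
  · rw [Pi.smul_apply, smul_eq_mul, div_mul_eq_mul_div, eq_div_iff hi, mul_comm, hentry]
    ring

theorem twistedEmbedding_injective (σ : F ≃+* F) :
    Function.Injective (twistedEmbedding (n := n) σ) := by
  intro P Q h
  obtain ⟨c, hc⟩ := (Projectivization.mk_eq_mk_iff' ..).1 h
  have hne : σ ∘ P.pt.rep ≠ 0 := fun h => P.pt.rep_nonzero <| funext fun i =>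
    (map_eq_zero σ).1 (congrFun h i)
  obtain ⟨⟨a, ha⟩, b, hb⟩ := exists_eq_smul_of_vecMulVec_eq_smul hne P.hyp.rep_nonzero hc.symm
  have hpt : σ.symm a • Q.pt.rep = P.pt.rep := funext fun i => σ.injective <| by
    simpa using (congrFun ha i).symm
  ext1
  · rw [← P.pt.mk_rep, ← Q.pt.mk_rep]
    exact (Projectivization.mk_eq_mk_iff' ..).2 ⟨_, hpt⟩
  · rw [← P.hyp.mk_rep, ← Q.hyp.mk_rep]
    exact (Projectivization.mk_eq_mk_iff' ..).2 ⟨b, hb.symm⟩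

theorem exists_forall_eq_trace_mul {l m : Type*} [Fintype l] [Fintype m]
    (φ : Module.Dual F (Matrix l m F)) :
    ∃ M : Matrix m l F, ∀ X, φ X = (X * M).trace := by
  classical
  let M : Matrix m l F := Matrix.of fun i j => φ (Matrix.single j i 1)
  have h : φ = Matrix.traceLinearMap l F F ∘ₗ mulRightLinearMap l F M :=
    Matrix.ext_linearMap F fun i j => LinearMap.ext_ring <| by
      simp [M, Matrix.trace_single_mul]
  exact ⟨M, LinearMap.congr_fun h⟩

theorem mem_projectiveCode {Ω : Set (ℙ F (Matrix (Fin (n + 1)) (Fin (n + 1)) F))}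
    {X : Ω → Matrix (Fin (n + 1)) (Fin (n + 1)) F} {c : Ω → F} :
    c ∈ projectiveCode X ↔ ∃ M, codeword X M = c := by
  constructor
  · rintro ⟨φ, rfl⟩
    obtain ⟨M, hM⟩ := exists_forall_eq_trace_mul φ
    exact ⟨M, funext fun p => (hM (X p)).symm⟩
  · rintro ⟨M, rfl⟩
    exact ⟨Matrix.traceLinearMap (Fin (n + 1)) F F ∘ₗ LinearMap.mulRight F M, rfl⟩

variable {σ : F ≃+* F} {X : projectiveSystem n σ → Matrix (Fin (n + 1)) (Fin (n + 1)) F}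

theorem codeword_apply_eq_zero_iff (hX : IsRepresentatives X)
    (M : Matrix (Fin (n + 1)) (Fin (n + 1)) F) (P : PHPoint F n) :
    codeword X M ⟨twistedEmbedding σ P, P, rfl⟩ = 0 ↔ P ∈ arisingHyperplane σ M := by
  obtain ⟨h, hP : Projectivization.mk F _ h = twistedEmbedding σ P⟩ := hX ⟨_, P, rfl⟩
  have hspan := congrArg Projectivization.submodule hP
  rw [arisingHyperplane, Set.mem_ofPred_eq, ← hspan, Projectivization.submodule_mk,
    Submodule.span_singleton_le_iff_mem, mem_perp, codeword]

theorem weight_codeword (hX : IsRepresentatives X) (M : Matrix (Fin (n + 1)) (Fin (n + 1)) F) :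
    weight (codeword X M) = (arisingHyperplane σ M)ᶜ.ncard := by
  let e : PHPoint F n ≃ projectiveSystem n σ := Equiv.ofInjective _ (twistedEmbedding_injective σ)
  have hsupport : e ⁻¹' Function.support (codeword X M) = (arisingHyperplane σ M)ᶜ :=
    Set.ext fun P => (codeword_apply_eq_zero_iff hX M P).not
  rw [weight, ← hsupport, Set.ncard_preimage_of_injective_subset_range e.injective
    fun p _ => e.surjective p]

theorem ncard_compl_arisingHyperplane [Finite F] (σ : F ≃+* F)
    (M : Matrix (Fin (n + 1)) (Fin (n + 1)) F) :
    (arisingHyperplane σ M)ᶜ.ncard =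
      Nat.card F ^ (n - 1) * (eigenpoints (twistedMap (σ : F →+* F) M))ᶜ.ncard := by
  set f := twistedMap (σ : F →+* F) M
  have hgood : ∀ p : PG F n, p ∉ eigenpoints f ↔ f p.rep ∉ F ∙ p.rep := fun p => by
    rw [eigenpoints, Set.mem_ofPred_eq, p.submodule_eq]
  let A (p : PG F n) : Set (DualPG F n) := {H | H.rep ⬝ᵥ p.rep = 0 ∧ H.rep ⬝ᵥ f p.rep ≠ 0}
  let e : ((arisingHyperplane σ M)ᶜ : Set (PHPoint F n)) ≃
      Σ p : ((eigenpoints f)ᶜ : Set (PG F n)), A p :=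
    { toFun := fun P => ⟨⟨P.1.pt, (hgood _).2 fun h => P.2 <| mem_arisingHyperplane.2 <| by
          obtain ⟨a, ha⟩ := Submodule.mem_span_singleton.1 h
          rw [← ha, dotProduct_smul, incident_iff_rep.1 P.1.incident, smul_zero]⟩,
        ⟨P.1.hyp, incident_iff_rep.1 P.1.incident, fun h => P.2 (mem_arisingHyperplane.2 h)⟩⟩
      invFun := fun Q => ⟨⟨Q.1.1, Q.2.1, incident_iff_rep.2 Q.2.2.1⟩,
        fun h => Q.2.2.2 (mem_arisingHyperplane.1 h)⟩
      left_inv := fun P => rfl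
      right_inv := fun Q => rfl }
  have hA (p : ((eigenpoints f)ᶜ : Set (PG F n))) : Nat.card (A p) = Nat.card F ^ (n - 1) :=
    (Nat.card_coe_set_eq _).trans <|
      (ncard_hyperplanes_through_avoiding p.1.rep_nonzero ((hgood _).1 p.2)).trans <| by
        rw [Fintype.card_fin, Nat.add_sub_add_right n 1 1]
  have := Fintype.ofFinite ((eigenpoints f)ᶜ : Set (PG F n))
  rw [← Nat.card_coe_set_eq, Nat.card_congr e, Nat.card_sigma, Finset.sum_congr rfl fun p _ => hA p,
    Finset.sum_const, Finset.card_univ, smul_eq_mul, mul_comm, ← Nat.card_eq_fintype_card,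
    Nat.card_coe_set_eq]

theorem weight_codeword_eq_mul [Finite F] (hX : IsRepresentatives X)
    (M : Matrix (Fin (n + 1)) (Fin (n + 1)) F) :
    weight (codeword X M) =
      Nat.card F ^ (n - 1) * (eigenpoints (twistedMap (σ : F →+* F) M))ᶜ.ncard := by
  rw [weight_codeword hX, ncard_compl_arisingHyperplane]

theorem ncard_eigenpoints_add_ncard_compl [Finite F] {τ : F →+* F}
    (f : (Fin (n + 1) → F) →ₛₗ[τ] (Fin (n + 1) → F)) :
    (eigenpoints f).ncard + (eigenpoints f)ᶜ.ncard =
      ∑ i ∈ Finset.range (n + 1), Nat.card F ^ i := by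
  rw [Set.ncard_add_ncard_compl, Projectivization.card_of_finrank F _ (Module.finrank_fin_fun F)]

theorem twistedMap_mem_span_of_arisingHyperplane_subset
    {M M' : Matrix (Fin (n + 1)) (Fin (n + 1)) F}
    (h : arisingHyperplane σ M ⊆ arisingHyperplane σ M') (x : Fin (n + 1) → F) :
    twistedMap (σ : F →+* F) M' x ∈
      Submodule.span F {x, twistedMap (σ : F →+* F) M x} := by
  rcases eq_or_ne x 0 with rfl | hx
  · rw [(twistedMap (σ : F →+* F) M').map_zero]
    exact Submodule.zero_mem _
  by_contra hnotMem
  obtain ⟨ξ, hle, hξ⟩ := exists_dotProduct_ne_zero hnotMem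
  have hξ0 : ξ ≠ 0 := fun h0 => hξ (by rw [h0, zero_dotProduct])
  have hinc : Incident (Projectivization.mk F x hx) (Projectivization.mk F ξ hξ0) :=
    hle (Submodule.mem_span_of_mem (Set.mem_insert _ _))
  have hmem := (mk_mem_arisingHyperplane (M := M) hx hξ0 hinc).2
    (hle (Submodule.mem_span_of_mem (Set.mem_insert_of_mem _ rfl)))
  exact hξ ((mk_mem_arisingHyperplane hx hξ0 hinc).1 (h hmem))

theorem codeword_zero {Ω : Set (ℙ F (Matrix (Fin (n + 1)) (Fin (n + 1)) F))}
    (X : Ω → Matrix (Fin (n + 1)) (Fin (n + 1)) F) : codeword X 0 = 0 :=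
  funext fun p => by rw [codeword, mul_zero, Matrix.trace_zero, Pi.zero_apply]

theorem codeword_eq_zero_iff (hX : IsRepresentatives X) (hσ : σ ≠ 1) (hn : 1 ≤ n)
    {M : Matrix (Fin (n + 1)) (Fin (n + 1)) F} : codeword X M = 0 ↔ M = 0 := by
  refine ⟨fun h => ?_, fun h => h ▸ codeword_zero X⟩
  have hsub : arisingHyperplane σ 0 ⊆ arisingHyperplane σ M := fun P _ =>
    (codeword_apply_eq_zero_iff hX M P).1 (congrFun h _)
  have hscalar : ∀ x, ∃ a : F, twistedMap (σ : F →+* F) M x = a • x := fun x => by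
    have hmem := twistedMap_mem_span_of_arisingHyperplane_subset hsub x
    obtain ⟨a, b, hab⟩ := Submodule.mem_span_pair.1 hmem
    rw [twistedMap_zero, LinearMap.zero_apply, smul_zero, add_zero] at hab
    exact ⟨a, hab.symm⟩
  have hfinrank : 2 ≤ Module.finrank F (Fin (n + 1) → F) := by
    rwa [Module.finrank_fin_fun, Nat.succ_le_succ_iff]
  exact twistedMap_injective (σ : F →+* F) <|
    (eq_zero_of_forall_exists_map_eq_smul (coe_ne_id hσ) hfinrank hscalar).trans
      (twistedMap_zero _).symm

end WeightFormula

/-! ### Matrices of rank one and quasi-singular hyperplanes -/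

section RankOne

theorem exists_map_eq_smul_of_ker_le {F V W : Type*} [Field F] [AddCommGroup V] [Module F V]
    [AddCommGroup W] [Module F W] {σ : F →+* F} {f : V →ₛₗ[σ] W} {φ : Module.Dual F V}
    (h : LinearMap.ker φ ≤ LinearMap.ker f) : ∃ w : W, ∀ y, f y = σ (φ y) • w := by
  rcases eq_or_ne φ 0 with rfl | hφ
  · exact ⟨0, fun y => (h (LinearMap.zero_apply y)).trans (smul_zero _).symm⟩
  · obtain ⟨x, hx⟩ := LinearMap.surjective hφ 1
    refine ⟨f x, fun y => ?_⟩
    have hy : y - φ y • x ∈ LinearMap.ker f := h <| by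
      rw [LinearMap.mem_ker, map_sub, map_smul, hx, smul_eq_mul, mul_one, sub_self]
    rwa [LinearMap.mem_ker, map_sub, sub_eq_zero, map_smulₛₗ] at hy

variable {F ι : Type*} [Field F]

theorem vecMulVec_comp_ne_zero (σ : F →+* F) {a b : ι → F} (ha : a ≠ 0) (hb : b ≠ 0) :
    Matrix.vecMulVec a (σ ∘ b) ≠ 0 :=
  Matrix.vecMulVec_ne_zero ha (by simpa [funext_iff] using hb)

variable [Fintype ι]

theorem twistedMap_vecMulVec (σ : F →+* F) (a b x : ι → F) :
    twistedMap σ (Matrix.vecMulVec a (σ ∘ b)) x = σ (b ⬝ᵥ x) • a := by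
  rw [twistedMap_apply, Matrix.vecMulVec_mulVec, op_smul_eq_smul, RingHom.map_dotProduct]

theorem exists_eq_vecMulVec_of_le_finrank_ker {σ : F →+* F} {M : Matrix ι ι F} (hM : M ≠ 0)
    (h : Fintype.card ι ≤ Module.finrank F (LinearMap.ker (twistedMap σ M)) + 1) :
    ∃ a b : ι → F, a ≠ 0 ∧ b ≠ 0 ∧ M = Matrix.vecMulVec a (σ ∘ b) := by
  obtain ⟨x, hx⟩ := DFunLike.ne_iff.1 (twistedMap_ne_zero (σ := σ) hM)
  obtain ⟨b, hle, hbx⟩ := exists_dotProduct_ne_zero (U := LinearMap.ker (twistedMap σ M)) hx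
  have hb : b ≠ 0 := fun h0 => hbx (by rw [h0, zero_dotProduct])
  have hker : LinearMap.ker (twistedMap σ M) = LinearMap.ker (dotProductBilin F F b) := by
    refine Submodule.eq_of_le_of_finrank_le hle ?_
    rwa [← Nat.add_le_add_iff_right (n := 1), finrank_ker_dotProductBilin_add_one hb]
  obtain ⟨a, ha⟩ := exists_map_eq_smul_of_ker_le hker.ge
  have hMab : M = Matrix.vecMulVec a (σ ∘ b) := twistedMap_injective σ <| LinearMap.ext fun y =>
    (ha y).trans (twistedMap_vecMulVec σ a b y).symm
  refine ⟨a, b, fun ha0 => hM ?_, hb, hMab⟩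
  rw [hMab, ha0, Matrix.zero_vecMulVec]

variable {σ : F →+* F} {a b : ι → F}

theorem eigenpoints_vecMulVec (ha : a ≠ 0) :
    eigenpoints (twistedMap σ (Matrix.vecMulVec a (σ ∘ b))) =
      insert (Projectivization.mk F a ha)
        {p | p.submodule ≤ LinearMap.ker (dotProductBilin F F b)} := by
  ext p
  induction p with | h x hx =>
  rw [mk_mem_eigenpoints, twistedMap_vecMulVec, Set.mem_insert_iff, Set.mem_ofPred_eq,
    Projectivization.submodule_mk, Submodule.span_singleton_le_iff_mem,
    Projectivization.mk_eq_mk_iff', LinearMap.mem_ker, dotProductBilin_apply_apply]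
  constructor
  · rintro ⟨c, hc⟩
    refine or_iff_not_imp_right.2 fun hbx => ?_
    have hσ : σ (b ⬝ᵥ x) ≠ 0 := (map_ne_zero σ).2 hbx
    have hc0 : c ≠ 0 := by
      rintro rfl
      exact smul_ne_zero hσ ha (hc.trans (zero_smul F x))
    exact ⟨c⁻¹ * σ (b ⬝ᵥ x), by rw [mul_smul, hc, inv_smul_smul₀ hc0]⟩
  · rintro (⟨c, rfl⟩ | hbx)
    · have hc0 : c ≠ 0 := by
        rintro rfl
        exact hx (zero_smul F a)
      exact ⟨σ (b ⬝ᵥ c • a) * c⁻¹, by rw [mul_smul, inv_smul_smul₀ hc0]⟩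
    · exact ⟨0, by rw [hbx, map_zero, zero_smul, zero_smul]⟩

theorem ncard_eigenpoints_vecMulVec_of_eq_zero [Finite F] (ha : a ≠ 0) (hb : b ≠ 0)
    (hab : b ⬝ᵥ a = 0) :
    (eigenpoints (twistedMap σ (Matrix.vecMulVec a (σ ∘ b)))).ncard =
      ∑ i ∈ Finset.range (Fintype.card ι - 1), Nat.card F ^ i := by
  rw [eigenpoints_vecMulVec ha, Set.insert_eq_of_mem, ncard_submodule_le,
    ← finrank_ker_dotProductBilin_add_one hb, Nat.add_sub_cancel]
  rw [Set.mem_ofPred_eq, Projectivization.submodule_mk, Submodule.span_singleton_le_iff_mem]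
  exact hab

theorem ncard_eigenpoints_vecMulVec_of_ne_zero [Finite F] (ha : a ≠ 0) (hb : b ≠ 0)
    (hab : b ⬝ᵥ a ≠ 0) :
    (eigenpoints (twistedMap σ (Matrix.vecMulVec a (σ ∘ b)))).ncard =
      ∑ i ∈ Finset.range (Fintype.card ι - 1), Nat.card F ^ i + 1 := by
  rw [eigenpoints_vecMulVec ha, Set.ncard_insert_of_notMem, ncard_submodule_le,
    ← finrank_ker_dotProductBilin_add_one hb, Nat.add_sub_cancel]
  rw [Set.mem_ofPred_eq, Projectivization.submodule_mk, Submodule.span_singleton_le_iff_mem]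
  exact hab

end RankOne

section QuasiSingular

theorem exists_submodule_finrank_eq_between {F V : Type*} [Field F] [AddCommGroup V] [Module F V]
    [FiniteDimensional F V] {U W : Submodule F V} (hUW : U ≤ W) {k : ℕ}
    (hU : Module.finrank F U ≤ k) (hW : k ≤ Module.finrank F W) :
    ∃ S : Submodule F V, U ≤ S ∧ S ≤ W ∧ Module.finrank F S = k := by
  induction k, hU using Nat.le_induction with
  | base => exact ⟨U, le_rfl, hUW, rfl⟩
  | succ k _ ih =>
    obtain ⟨S, hUS, hSW, hS⟩ := ih (Nat.le_of_succ_le hW)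
    obtain ⟨v, hvW, hvS⟩ : ∃ v ∈ W, v ∉ S := SetLike.not_le_iff_exists.1 fun h =>
      (hW.trans (Submodule.finrank_mono h)).not_gt (hS ▸ Nat.lt_succ_self k)
    exact ⟨S ⊔ F ∙ v, hUS.trans le_sup_left,
      sup_le hSW ((Submodule.span_singleton_le_iff_mem v W).2 hvW), by
        rw [Submodule.finrank_sup_span_singleton hvS, hS]⟩

variable {F : Type*} [Field F] {n : ℕ} {p : PG F n} {A H K : DualPG F n}

theorem submodule_le_hyperplane : p.submodule ≤ hyperplane H ↔ Incident p H := by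
  rw [submodule_le_iff_rep_mem, incident_iff_rep]
  rfl

theorem finrank_hyperplane (H : DualPG F n) : Module.finrank F (hyperplane H) = n := by
  have h := finrank_ker_dotProductBilin_add_one H.rep_nonzero
  rwa [Fintype.card_fin, Nat.succ_inj] at h

theorem le_finrank_hyperplane_inf (H K : DualPG F n) :
    n - 1 ≤ Module.finrank F (hyperplane H ⊓ hyperplane K : Submodule F (Fin (n + 1) → F)) := by
  have hsum := Submodule.finrank_sup_add_finrank_inf_eq (hyperplane H) (hyperplane K)
  have hsup := Submodule.finrank_le (hyperplane H ⊔ hyperplane K)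
  rw [finrank_hyperplane, finrank_hyperplane] at hsum
  rw [Module.finrank_fin_fun] at hsup
  omega

theorem Collinear.pt_eq_or_hyp_eq {P Q : PHPoint F n} (h : Collinear P Q) :
    P.pt = Q.pt ∨ P.hyp = Q.hyp := by
  obtain ⟨l, ⟨r, H, -, -, rfl⟩ | ⟨x, S, -, -, rfl⟩, hP, hQ⟩ := h
  · exact Or.inr (hP.1.trans hQ.1.symm)
  · exact Or.inl (hP.1.trans hQ.1.symm)

theorem collinear_of_hyp_eq (hn : 2 ≤ n) {P Q : PHPoint F n} (h : P.hyp = Q.hyp) :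
    Collinear P Q := by
  have hfinrank : Module.finrank F (P.pt.submodule ⊔ Q.pt.submodule : Submodule F _) ≤ 2 :=
    (Submodule.finrank_add_le_finrank_add_finrank _ _).trans_eq <| by
      rw [Projectivization.finrank_submodule, Projectivization.finrank_submodule]
  obtain ⟨r, hle, hr, hr2⟩ := exists_submodule_finrank_eq_between (W := hyperplane P.hyp)
    (sup_le (submodule_le_hyperplane.2 P.incident) (submodule_le_hyperplane.2 (h ▸ Q.incident)))
    hfinrank (by rwa [finrank_hyperplane])
  exact ⟨_, Or.inl ⟨r, P.hyp, hr2, hr, rfl⟩, ⟨rfl, le_sup_left.trans hle⟩,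
    ⟨h.symm, le_sup_right.trans hle⟩⟩

theorem collinear_of_pt_eq (hn : 2 ≤ n) {P Q : PHPoint F n} (h : P.pt = Q.pt) :
    Collinear P Q := by
  obtain ⟨S, hP, hS, hfinrank⟩ := exists_submodule_finrank_eq_between (k := n - 1)
    (le_inf (submodule_le_hyperplane.2 P.incident) (submodule_le_hyperplane.2 (h ▸ Q.incident)))
    (by rw [Projectivization.finrank_submodule]; omega) (le_finrank_hyperplane_inf P.hyp Q.hyp)
  exact ⟨_, Or.inr ⟨P.pt, S, by omega, hP, rfl⟩, ⟨rfl, hS.trans inf_le_left⟩,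
    ⟨h.symm, hS.trans inf_le_right⟩⟩

theorem mem_quasiSingular (hn : 2 ≤ n) {P : PHPoint F n} :
    P ∈ quasiSingular p A ↔ Incident p P.hyp ∨ Incident P.pt A := by
  constructor
  · rintro ⟨Q, rfl | rfl, hPQ⟩ <;> rcases hPQ.pt_eq_or_hyp_eq with h | h
    · exact Or.inl (h ▸ P.incident)
    · exact Or.inl (h ▸ Q.incident)
    · exact Or.inr (h ▸ Q.incident)
    · exact Or.inr (h ▸ P.incident)
  · rintro (h | h)
    · exact ⟨⟨p, P.hyp, h⟩, Or.inl rfl, collinear_of_hyp_eq hn rfl⟩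
    · exact ⟨⟨P.pt, A, h⟩, Or.inr rfl, collinear_of_pt_eq hn rfl⟩

theorem quasiSingular_mk_eq_arisingHyperplane (hn : 2 ≤ n) (σ : F ≃+* F)
    {a b : Fin (n + 1) → F} (ha : a ≠ 0) (hb : b ≠ 0) :
    quasiSingular (Projectivization.mk F a ha) (Projectivization.mk F b hb) =
      arisingHyperplane σ (Matrix.vecMulVec a (σ ∘ b)) := by
  ext ⟨p, H, h⟩
  induction p using Projectivization.ind with | h x hx =>
  induction H using Projectivization.ind with | h ξ hξ =>
  rw [mem_quasiSingular hn, mk_mem_arisingHyperplane, ← RingEquiv.coe_toRingHom,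
    twistedMap_vecMulVec, dotProduct_smul, smul_eq_mul, mul_eq_zero, map_eq_zero, or_comm]
  rfl

theorem exists_quasiSingular_eq_arisingHyperplane (hn : 2 ≤ n) (σ : F ≃+* F) (p : PG F n)
    (A : DualPG F n) :
    ∃ a b : Fin (n + 1) → F, a ≠ 0 ∧ b ≠ 0 ∧ (Incident p A ↔ b ⬝ᵥ a = 0) ∧
      quasiSingular p A = arisingHyperplane σ (Matrix.vecMulVec a (σ ∘ b)) := by
  induction p using Projectivization.ind with | h a ha =>
  induction A using Projectivization.ind with | h b hb =>
  exact ⟨a, b, ha, hb, Iff.rfl, quasiSingular_mk_eq_arisingHyperplane hn σ ha hb⟩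

theorem IsQuasiSingular.exists_eq_arisingHyperplane {H : Set (PHPoint F n)}
    (hH : IsQuasiSingular H) (hn : 2 ≤ n) (σ : F ≃+* F) :
    ∃ M : Matrix (Fin (n + 1)) (Fin (n + 1)) F, M ≠ 0 ∧ H = arisingHyperplane σ M := by
  obtain ⟨p, A, rfl⟩ := hH
  obtain ⟨a, b, ha, hb, -, hH⟩ := exists_quasiSingular_eq_arisingHyperplane hn σ p A
  exact ⟨_, vecMulVec_comp_ne_zero (σ : F →+* F) ha hb, hH⟩

end QuasiSingular

/-! ### The lowest weights -/

section Weights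

variable {F ι : Type*} [Field F] {C : Submodule F (ι → F)} {c : ι → F} {w : ℕ}

theorem isMinimumWeightCodeword_iff (hw : IsLeast (weights C) w) (hc : c ∈ C) (h0 : c ≠ 0) :
    IsMinimumWeightCodeword C c ↔ weight c = w :=
  ⟨fun h => h.2.2.unique hw, fun h => ⟨hc, h0, h ▸ hw⟩⟩

theorem isSecondLowestWeightCodeword_iff (hw : IsLeast (nonMinimumWeights C) w) (hc : c ∈ C)
    (h0 : c ≠ 0) : IsSecondLowestWeightCodeword C c ↔ weight c = w :=
  ⟨fun h => h.2.2.unique hw, fun h => ⟨hc, h0, h ▸ hw⟩⟩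

end Weights

section FewEigenpoints

theorem sum_pow_add_sum_pow_lt {q s d m n : ℕ} (hs : 2 ≤ s) (hd : d < n) (h : s ^ m ≤ q ^ (n - 1)) :
    ∑ i ∈ Finset.range d, q ^ i + ∑ i ∈ Finset.range m, s ^ i < ∑ i ∈ Finset.range n, q ^ i :=
  calc ∑ i ∈ Finset.range d, q ^ i + ∑ i ∈ Finset.range m, s ^ i
    _ < ∑ i ∈ Finset.range d, q ^ i + s ^ m :=
      Nat.add_lt_add_left (Nat.geomSum_lt hs fun _ => Finset.mem_range.1) _
    _ ≤ ∑ i ∈ Finset.range (n - 1), q ^ i + q ^ (n - 1) :=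
      Nat.add_le_add (Finset.sum_le_sum_of_subset (Finset.range_mono (Nat.le_sub_one_of_lt hd))) h
    _ = ∑ i ∈ Finset.range n, q ^ i := by
      rw [← Finset.sum_range_succ, Nat.sub_add_cancel (Nat.one_le_of_lt hd)]

variable {F V : Type*} [Field F] [AddCommGroup V] [Module F V] [Finite F] [Finite V]
  {σ : F ≃+* F} {f : V →ₛₗ[(σ : F →+* F)] V} {n : ℕ}

theorem ncard_eigenpoints_lt (hσ : σ ≠ 1) (hn : 2 ≤ n) (h : 2 < n ∨ σ ^ 2 ≠ 1)
    (hV : Module.finrank F V = n + 1) (hf : Module.finrank F (LinearMap.ker f) < n) :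
    (eigenpoints f).ncard < ∑ i ∈ Finset.range n, Nat.card F ^ i := by
  refine (ncard_eigenpoints_le_sum_add_sum f).trans_lt <|
    sum_pow_add_sum_pow_lt (two_le_card_fixedField _) hf ?_
  obtain ⟨k, hk, hle⟩ : ∃ k ≤ orderOf σ,
      Module.finrank F V - Module.finrank F (LinearMap.ker f) ≤ k * (n - 1) := by
    rcases h with hn3 | hσ2
    · exact ⟨2, two_le_orderOf hσ, by omega⟩
    · exact ⟨3, three_le_orderOf hσ hσ2, by omega⟩
  calc Nat.card (fixedField (σ : F →+* F)) ^ _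
    _ ≤ Nat.card (fixedField (σ : F →+* F)) ^ (k * (n - 1)) := Nat.pow_le_pow_right Nat.card_pos hle
    _ ≤ Nat.card F ^ (n - 1) := by
      rw [pow_mul]
      exact Nat.pow_le_pow_left (card_fixedField_pow_le hk) _

end FewEigenpoints

section LowWeights

variable {F : Type*} [Field F] {n : ℕ} {σ : F ≃+* F}
  {X : projectiveSystem n σ → Matrix (Fin (n + 1)) (Fin (n + 1)) F}

theorem mem_weights_iff (hX : IsRepresentatives X) (hσ : σ ≠ 1) (hn : 1 ≤ n) {w : ℕ} :
    w ∈ weights (projectiveCode X) ↔ ∃ M, M ≠ 0 ∧ weight (codeword X M) = w := by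
  constructor
  · rintro ⟨c, hc, hc0, hw⟩
    obtain ⟨M, rfl⟩ := mem_projectiveCode.1 hc
    exact ⟨M, mt (codeword_eq_zero_iff hX hσ hn).2 hc0, hw⟩
  · rintro ⟨M, hM, hw⟩
    exact ⟨_, mem_projectiveCode.2 ⟨M, rfl⟩, mt (codeword_eq_zero_iff hX hσ hn).1 hM, hw⟩

variable [Finite F] {a b : Fin (n + 1) → F}

theorem weight_codeword_vecMulVec_of_eq_zero (hX : IsRepresentatives X) (hn : 1 ≤ n)
    (ha : a ≠ 0) (hb : b ≠ 0) (hab : b ⬝ᵥ a = 0) :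
    weight (codeword X (Matrix.vecMulVec a (σ ∘ b))) = Nat.card F ^ (2 * n - 1) := by
  have hcard := ncard_eigenpoints_add_ncard_compl
    (twistedMap (σ : F →+* F) (Matrix.vecMulVec a ((σ : F →+* F) ∘ b)))
  rw [ncard_eigenpoints_vecMulVec_of_eq_zero ha hb hab, Fintype.card_fin, Nat.add_sub_cancel,
    Finset.sum_range_succ, Nat.add_left_cancel_iff, RingEquiv.coe_toRingHom] at hcard
  rw [weight_codeword_eq_mul hX, hcard, ← pow_add]
  congr 1
  omega

theorem weight_codeword_vecMulVec_of_ne_zero (hX : IsRepresentatives X) (hn : 1 ≤ n)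
    (ha : a ≠ 0) (hb : b ≠ 0) (hab : b ⬝ᵥ a ≠ 0) :
    weight (codeword X (Matrix.vecMulVec a (σ ∘ b))) =
      Nat.card F ^ (2 * n - 1) - Nat.card F ^ (n - 1) := by
  have hcard := ncard_eigenpoints_add_ncard_compl
    (twistedMap (σ : F →+* F) (Matrix.vecMulVec a ((σ : F →+* F) ∘ b)))
  rw [ncard_eigenpoints_vecMulVec_of_ne_zero ha hb hab, Fintype.card_fin, Nat.add_sub_cancel,
    Finset.sum_range_succ, add_assoc, Nat.add_left_cancel_iff, RingEquiv.coe_toRingHom] at hcard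
  rw [weight_codeword_eq_mul hX, show 2 * n - 1 = (n - 1) + n by omega, pow_add, ← hcard, mul_add,
    mul_one, Nat.add_sub_cancel_left]

variable {M : Matrix (Fin (n + 1)) (Fin (n + 1)) F}

theorem card_pow_lt_weight_codeword (hX : IsRepresentatives X) (hσ : σ ≠ 1) (hn : 2 ≤ n)
    (h : 2 < n ∨ σ ^ 2 ≠ 1)
    (hd : Module.finrank F (LinearMap.ker (twistedMap (σ : F →+* F) M)) < n) :
    Nat.card F ^ (2 * n - 1) < weight (codeword X M) := by
  have hlt := ncard_eigenpoints_lt hσ hn h (Module.finrank_fin_fun F) hd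
  have hcard := ncard_eigenpoints_add_ncard_compl (twistedMap (σ : F →+* F) M)
  rw [Finset.sum_range_succ] at hcard
  rw [weight_codeword_eq_mul hX, show 2 * n - 1 = (n - 1) + n by omega, pow_add]
  exact Nat.mul_lt_mul_of_pos_left (by omega) (pow_pos Nat.card_pos _)

theorem weight_codeword_of_isSingular (hX : IsRepresentatives X) (hn : 2 ≤ n)
    (h : IsSingular (arisingHyperplane σ M)) :
    weight (codeword X M) = Nat.card F ^ (2 * n - 1) := by
  obtain ⟨p, A, hpA, hM⟩ := h
  obtain ⟨a, b, ha, hb, hab, hqs⟩ := exists_quasiSingular_eq_arisingHyperplane hn σ p A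
  rw [weight_codeword hX, hM, hqs, ← weight_codeword hX,
    weight_codeword_vecMulVec_of_eq_zero hX (Nat.one_le_of_lt hn) ha hb (hab.1 hpA)]

theorem weight_codeword_of_isQuasiSingular (hX : IsRepresentatives X) (hn : 2 ≤ n)
    (h : IsQuasiSingular (arisingHyperplane σ M)) (h' : ¬ IsSingular (arisingHyperplane σ M)) :
    weight (codeword X M) = Nat.card F ^ (2 * n - 1) - Nat.card F ^ (n - 1) := by
  obtain ⟨p, A, hM⟩ := h
  obtain ⟨a, b, ha, hb, hab, hqs⟩ := exists_quasiSingular_eq_arisingHyperplane hn σ p A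
  rw [weight_codeword hX, hM, hqs, ← weight_codeword hX,
    weight_codeword_vecMulVec_of_ne_zero hX (Nat.one_le_of_lt hn) ha hb
      fun h0 => h' ⟨p, A, hab.2 h0, hM⟩]

theorem isQuasiSingular_or_card_pow_lt_weight_codeword (hX : IsRepresentatives X) (hσ : σ ≠ 1)
    (hn : 2 ≤ n) (h : 2 < n ∨ σ ^ 2 ≠ 1) (hM : M ≠ 0) :
    IsQuasiSingular (arisingHyperplane σ M) ∨
      Nat.card F ^ (2 * n - 1) < weight (codeword X M) := by
  rcases lt_or_ge (Module.finrank F (LinearMap.ker (twistedMap (σ : F →+* F) M))) n with hd | hd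
  · exact Or.inr (card_pow_lt_weight_codeword hX hσ hn h hd)
  · obtain ⟨a, b, ha, hb, rfl⟩ := exists_eq_vecMulVec_of_le_finrank_ker hM
      ((Fintype.card_fin _).trans_le (Nat.succ_le_succ hd))
    exact Or.inl ⟨_, _, (quasiSingular_mk_eq_arisingHyperplane hn σ ha hb).symm⟩

theorem weight_codeword_trichotomy (hX : IsRepresentatives X) (hσ : σ ≠ 1) (hn : 2 ≤ n)
    (h : 2 < n ∨ σ ^ 2 ≠ 1) (hM : M ≠ 0) :
    ((IsQuasiSingular (arisingHyperplane σ M) ∧ ¬ IsSingular (arisingHyperplane σ M)) ∧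
        weight (codeword X M) = Nat.card F ^ (2 * n - 1) - Nat.card F ^ (n - 1)) ∨
      (IsSingular (arisingHyperplane σ M) ∧
        weight (codeword X M) = Nat.card F ^ (2 * n - 1)) ∨
      Nat.card F ^ (2 * n - 1) < weight (codeword X M) := by
  by_cases hs : IsSingular (arisingHyperplane σ M)
  · exact Or.inr (Or.inl ⟨hs, weight_codeword_of_isSingular hX hn hs⟩)
  · rcases isQuasiSingular_or_card_pow_lt_weight_codeword hX hσ hn h hM with hqs | hlt
    · exact Or.inl ⟨⟨hqs, hs⟩, weight_codeword_of_isQuasiSingular hX hn hqs hs⟩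
    · exact Or.inr (Or.inr hlt)

theorem sub_card_pow_lt_card_pow (F : Type*) [Field F] [Finite F] {k m : ℕ} :
    Nat.card F ^ m - Nat.card F ^ k < Nat.card F ^ m :=
  Nat.sub_lt (pow_pos Nat.card_pos _) (pow_pos Nat.card_pos _)

theorem isLeast_weights (hX : IsRepresentatives X) (hσ : σ ≠ 1) (hn : 2 ≤ n)
    (h : 2 < n ∨ σ ^ 2 ≠ 1) :
    IsLeast (weights (projectiveCode X)) (Nat.card F ^ (2 * n - 1) - Nat.card F ^ (n - 1)) := by
  have hn1 : 1 ≤ n := Nat.one_le_of_lt hn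
  constructor
  · have he : (Pi.single 0 1 : Fin (n + 1) → F) ≠ 0 := Pi.single_ne_zero_iff.2 one_ne_zero
    refine (mem_weights_iff hX hσ hn1).2 ⟨_, vecMulVec_comp_ne_zero (σ : F →+* F) he he,
      weight_codeword_vecMulVec_of_ne_zero hX hn1 he he ?_⟩
    rw [single_one_dotProduct, Pi.single_eq_same]
    exact one_ne_zero
  · intro w hw
    obtain ⟨M, hM, rfl⟩ := (mem_weights_iff hX hσ hn1).1 hw
    have hlt := sub_card_pow_lt_card_pow F (k := n - 1) (m := 2 * n - 1)
    rcases weight_codeword_trichotomy hX hσ hn h hM with ⟨-, hM⟩ | ⟨-, hM⟩ | hM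
    exacts [hM.ge, hM ▸ hlt.le, (hlt.trans hM).le]

theorem isLeast_nonMinimumWeights (hX : IsRepresentatives X) (hσ : σ ≠ 1) (hn : 2 ≤ n)
    (h : 2 < n ∨ σ ^ 2 ≠ 1) :
    IsLeast (nonMinimumWeights (projectiveCode X)) (Nat.card F ^ (2 * n - 1)) := by
  have hn1 : 1 ≤ n := Nat.one_le_of_lt hn
  have hmin := isLeast_weights hX hσ hn h
  constructor
  · refine ⟨?_, _, hmin.1, sub_card_pow_lt_card_pow F⟩
    have he : ∀ i, (Pi.single i 1 : Fin (n + 1) → F) ≠ 0 := fun i =>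
      Pi.single_ne_zero_iff.2 one_ne_zero
    refine (mem_weights_iff hX hσ hn1).2 ⟨_,
      vecMulVec_comp_ne_zero (σ : F →+* F) (he (Fin.last n)) (he 0),
      weight_codeword_vecMulVec_of_eq_zero hX hn1 (he _) (he _) ?_⟩
    rw [single_one_dotProduct, Pi.single_eq_of_ne]
    exact Fin.ne_of_lt (Fin.lt_def.2 hn1)
  · rintro w ⟨hw, v, hv, hvw⟩
    obtain ⟨M, hM, rfl⟩ := (mem_weights_iff hX hσ hn1).1 hw
    rcases weight_codeword_trichotomy hX hσ hn h hM with ⟨-, hM⟩ | ⟨-, hM⟩ | hM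
    exacts [absurd (hmin.2 hv) (hM ▸ hvw).not_ge, hM.ge, hM.le]

theorem isMinimumWeightCodeword_iff_isQuasiSingular (hX : IsRepresentatives X) (hσ : σ ≠ 1)
    (hn : 2 ≤ n) (h : 2 < n ∨ σ ^ 2 ≠ 1) (hM : M ≠ 0) :
    IsMinimumWeightCodeword (projectiveCode X) (codeword X M) ↔
      IsQuasiSingular (arisingHyperplane σ M) ∧ ¬ IsSingular (arisingHyperplane σ M) := by
  rw [isMinimumWeightCodeword_iff (isLeast_weights hX hσ hn h) (mem_projectiveCode.2 ⟨M, rfl⟩)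
    (mt (codeword_eq_zero_iff hX hσ (Nat.one_le_of_lt hn)).1 hM)]
  refine ⟨fun hw => ?_, fun ⟨hqs, hs⟩ => weight_codeword_of_isQuasiSingular hX hn hqs hs⟩
  have hlt := sub_card_pow_lt_card_pow F (k := n - 1) (m := 2 * n - 1)
  rcases weight_codeword_trichotomy hX hσ hn h hM with ⟨hqs, -⟩ | ⟨-, hM⟩ | hM
  exacts [hqs, absurd (hw.symm.trans hM) hlt.ne, absurd (hw ▸ hM) hlt.not_gt]

theorem isSecondLowestWeightCodeword_iff_isSingular (hX : IsRepresentatives X) (hσ : σ ≠ 1)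
    (hn : 2 ≤ n) (h : 2 < n ∨ σ ^ 2 ≠ 1) (hM : M ≠ 0) :
    IsSecondLowestWeightCodeword (projectiveCode X) (codeword X M) ↔
      IsSingular (arisingHyperplane σ M) := by
  rw [isSecondLowestWeightCodeword_iff (isLeast_nonMinimumWeights hX hσ hn h)
    (mem_projectiveCode.2 ⟨M, rfl⟩)
    (mt (codeword_eq_zero_iff hX hσ (Nat.one_le_of_lt hn)).1 hM)]
  refine ⟨fun hw => ?_, weight_codeword_of_isSingular hX hn⟩
  have hlt := sub_card_pow_lt_card_pow F (k := n - 1) (m := 2 * n - 1)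
  rcases weight_codeword_trichotomy hX hσ hn h hM with ⟨-, hM⟩ | ⟨hs, -⟩ | hM
  exacts [absurd (hM.symm.trans hw) hlt.ne, hs, absurd hw hM.ne']

end LowWeights

/-! ### Minimality -/

section Minimality

theorem exists_avoiding_pair {α β : Type*} {A : Finset α} {B : Finset β} {R S : α → β → Prop}
    (hA : 3 ≤ A.card) (hB : 3 ≤ B.card) (hR : ∀ b ∈ B, {a | R a b}.Subsingleton)
    (hS : ∀ a ∈ A, {b | S a b}.Subsingleton) : ∃ a ∈ A, ∃ b ∈ B, ¬ R a b ∧ ¬ S a b := by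
  classical
  by_contra! h
  have hrow : ∀ a ∈ A, B.card ≤ (B.bipartiteAbove R a).card + 1 := fun a ha => by
    have hle : (B.filter fun b => ¬ R a b).card ≤ 1 := Finset.card_le_one.2 fun b hb b' hb' => by
      rw [Finset.mem_filter] at hb hb'
      exact hS a ha (h a ha b hb.1 hb.2) (h a ha b' hb'.1 hb'.2)
    rw [← Finset.card_filter_add_card_filter_not (s := B) (R a)]
    exact Nat.add_le_add_left hle _
  have hcolumn : ∀ b ∈ B, (A.bipartiteBelow R b).card ≤ 1 := fun b hb =>
    Finset.card_le_one.2 fun a ha a' ha' =>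
      hR b hb (Finset.mem_filter.1 ha).2 (Finset.mem_filter.1 ha').2
  have hcount : A.card * B.card ≤ B.card + A.card :=
    calc A.card * B.card
      _ ≤ ∑ a ∈ A, ((B.bipartiteAbove R a).card + 1) := Finset.card_nsmul_le_sum _ _ _ hrow
      _ = ∑ b ∈ B, (A.bipartiteBelow R b).card + A.card := by
        rw [Finset.sum_add_distrib, Finset.sum_card_bipartiteAbove_eq_sum_card_bipartiteBelow,
          Finset.card_eq_sum_ones]
      _ ≤ B.card + A.card := by
        gcongr
        exact (Finset.sum_le_card_nsmul _ _ _ hcolumn).trans_eq (mul_one _)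
  nlinarith

theorem three_le_card_filter_not {α : Type*} [Fintype α] (hα : 4 ≤ Nat.card α) {P : α → Prop}
    [DecidablePred P] (hP : {a | P a}.Subsingleton) :
    3 ≤ (Finset.univ.filter fun a => ¬ P a).card := by
  have hle : (Finset.univ.filter P).card ≤ 1 := Finset.card_le_one.2 fun a ha b hb =>
    hP (Finset.mem_filter.1 ha).2 (Finset.mem_filter.1 hb).2
  have hsum := Finset.card_filter_add_card_filter_not (s := Finset.univ) P
  rw [Finset.card_univ, ← Nat.card_eq_fintype_card] at hsum
  omega

variable {F V : Type*} [Field F] [AddCommGroup V] [Module F V]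

theorem eq_of_forall_exists_smul_add_smul_eq_smul {v w : V} (hv : v ≠ 0) (hw : w ≠ 0) {b d : F}
    (h : ∀ k : F, ∃ e : F, d • w + (k * b) • v = e • (w + k • v)) : b = d := by
  by_cases hvw : LinearIndependent F ![v, w]
  · obtain ⟨e, he⟩ := h 1
    obtain ⟨hb, hd⟩ := LinearIndependent.pair_iff.1 hvw (b - e) (d - e) (by
      linear_combination (norm := module) he)
    exact (sub_eq_zero.1 hb).trans (sub_eq_zero.1 hd).symm
  · rw [LinearIndependent.pair_iff' hv] at hvw
    push Not at hvw
    obtain ⟨k, rfl⟩ := hvw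
    obtain ⟨e, he⟩ := h (-k)
    have hsmul : (d - b) • k • v = 0 := by linear_combination (norm := module) he
    exact (sub_eq_zero.1 ((smul_eq_zero.1 hsmul).resolve_right hw)).symm

theorem span_pair_add_smul_right (x v : V) (a : F) :
    Submodule.span F {x, v + a • x} = Submodule.span F {x, v} := by
  have hle : ∀ (v : V) (a : F), Submodule.span F {x, v + a • x} ≤ Submodule.span F {x, v} :=
    fun v a => Submodule.span_le.2 <| Set.pair_subset
      (Submodule.mem_span_of_mem (Set.mem_insert _ _))
      (Submodule.mem_span_pair.2 ⟨a, 1, by rw [one_smul, add_comm]⟩)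
  refine le_antisymm (hle v a) ?_
  have hge := hle (v + a • x) (-a)
  rwa [neg_smul, add_neg_cancel_right] at hge

theorem subsingleton_setOf_mem_span_pair {x y w u : V} (hxy : LinearIndependent F ![x, y])
    (hw : w ∉ Submodule.span F {x, y}) (hu : u ∉ F ∙ x) :
    {b : F | u ∈ Submodule.span F {x, w + b • y}}.Subsingleton := by
  rintro b hb b' hb'
  obtain ⟨c, d, hcd⟩ := Submodule.mem_span_pair.1 hb
  obtain ⟨c', d', hcd'⟩ := Submodule.mem_span_pair.1 hb'
  have hdd' : d = d' := by
    by_contra hne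
    refine hw ((Submodule.smul_mem_iff _ (sub_ne_zero.2 hne)).1
      (Submodule.mem_span_pair.2 ⟨c' - c, d' * b' - d * b, ?_⟩))
    linear_combination (norm := module) hcd' - hcd
  subst hdd'
  have hd : d ≠ 0 := by
    rintro rfl
    rw [zero_smul, add_zero] at hcd
    exact hu (Submodule.mem_span_singleton.2 ⟨c, hcd⟩)
  obtain ⟨-, h⟩ := LinearIndependent.pair_iff.1 hxy (c - c') (d * (b - b')) (by
    linear_combination (norm := module) hcd - hcd')
  exact sub_eq_zero.1 ((mul_eq_zero.1 h).resolve_left hd)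

theorem subsingleton_setOf_map_add_smul_mem {σ : F →+* F} {f : V →ₛₗ[σ] V} {x : V}
    {U : Submodule F V} (hx : f x ∉ U) (v : V) : {a : F | f (v + a • x) ∈ U}.Subsingleton := by
  intro a ha a' ha'
  by_contra hne
  have hmem := U.sub_mem ha ha'
  rw [← map_sub, add_sub_add_left_eq_sub, ← sub_smul, map_smulₛₗ] at hmem
  exact hx ((U.smul_mem_iff ((map_ne_zero σ).2 (sub_ne_zero.2 hne))).1 hmem)

theorem exists_map_notMem_span_pair [Finite F] (hF : 4 ≤ Nat.card F) {σ : F →+* F}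
    {f : V →ₛₗ[σ] V} {x y w : V} (hxy : LinearIndependent F ![x, y])
    (hw : w ∉ Submodule.span F {x, y}) (hx : f x ∉ F ∙ x) (hy : f y ∉ F ∙ y) :
    ∃ z, (f x ∉ Submodule.span F {x, z} ∧ f z ∉ Submodule.span F {x, z}) ∧
      f y ∉ Submodule.span F {y, z} ∧ f z ∉ Submodule.span F {y, z} := by
  classical
  have := Fintype.ofFinite F
  have hw' : w ∉ Submodule.span F {y, x} := by rwa [Set.pair_comm]
  obtain ⟨a, ha, b, hb, hR, hS⟩ := exists_avoiding_pair
    (R := fun a b => f (w + b • y + a • x) ∈ Submodule.span F {x, w + b • y})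
    (S := fun a b => f (w + a • x + b • y) ∈ Submodule.span F {y, w + a • x})
    (three_le_card_filter_not hF
      (subsingleton_setOf_mem_span_pair (LinearIndependent.pair_symm_iff.1 hxy) hw' hy))
    (three_le_card_filter_not hF (subsingleton_setOf_mem_span_pair hxy hw hx))
    (fun b hb => subsingleton_setOf_map_add_smul_mem (Finset.mem_filter.1 hb).2 _)
    (fun a ha => subsingleton_setOf_map_add_smul_mem (Finset.mem_filter.1 ha).2 _)
  have hz : w + b • y + a • x = w + a • x + b • y := add_right_comm _ _ _
  refine ⟨w + b • y + a • x, ?_, ?_⟩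
  · rw [span_pair_add_smul_right]
    exact ⟨(Finset.mem_filter.1 hb).2, hR⟩
  · rw [hz, span_pair_add_smul_right]
    exact ⟨(Finset.mem_filter.1 ha).2, hS⟩

variable {σ : F ≃+* F} {f g : V →ₛₗ[(σ : F →+* F)] V}

theorem eq_of_map_notMem_span_pair (h : ∀ z, g z ∈ Submodule.span F {z, f z}) {x y : V}
    (hx : f x ∉ Submodule.span F {x, y}) (hy : f y ∉ Submodule.span F {x, y}) {a b c d : F}
    (hgx : a • x + b • f x = g x) (hgy : c • y + d • f y = g y) : b = d := by
  have hxU : x ∈ Submodule.span F {x, y} := Submodule.mem_span_of_mem (Set.mem_insert _ _)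
  have hyU : y ∈ Submodule.span F {x, y} := Submodule.mem_span_of_mem (Set.mem_insert_of_mem _ rfl)
  set U := Submodule.span F {x, y}
  have hmkQ : ∀ v ∈ U, U.mkQ v = 0 := fun v => (Submodule.Quotient.mk_eq_zero U).2
  refine eq_of_forall_exists_smul_add_smul_eq_smul (v := U.mkQ (f x)) (w := U.mkQ (f y))
    (mt (Submodule.Quotient.mk_eq_zero U).1 hx) (mt (Submodule.Quotient.mk_eq_zero U).1 hy)
    fun k => ?_
  obtain ⟨t, rfl⟩ := σ.surjective k
  obtain ⟨r, e, hre⟩ := Submodule.mem_span_pair.1 (h (y + t • x))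
  refine ⟨e, ?_⟩
  have hmk := congrArg U.mkQ hre
  simp only [map_add, map_smulₛₗ, ← hgx, ← hgy, hmkQ x hxU, hmkQ y hyU, smul_zero, add_zero,
    zero_add, RingHom.id_apply, RingHom.coe_coe, smul_smul] at hmk
  rw [← hmk, smul_add, smul_smul]

theorem eq_of_map_notMem_span_singleton [Finite F] [FiniteDimensional F V] (hF : 4 ≤ Nat.card F)
    (hV : 3 ≤ Module.finrank F V) (h : ∀ z, g z ∈ Submodule.span F {z, f z}) {x y : V}
    (hx : f x ∉ F ∙ x) (hy : f y ∉ F ∙ y) {a b c d : F} (hgx : a • x + b • f x = g x)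
    (hgy : c • y + d • f y = g y) : b = d := by
  have hx0 : x ≠ 0 := by
    rintro rfl
    exact hx (by rw [f.map_zero]; exact Submodule.zero_mem _)
  by_cases hxy : LinearIndependent F ![x, y]
  · obtain ⟨w, hw⟩ : ∃ w, w ∉ Submodule.span F {x, y} := by
      obtain ⟨w, hw⟩ := exists_linearIndependent_snoc_of_lt_finrank hxy hV
      refine ⟨w, ?_⟩
      simpa only [Matrix.range_cons, Matrix.range_empty, Set.union_empty, Set.singleton_union]
        using (linearIndependent_finSnoc.1 hw).2
    obtain ⟨z, ⟨hxz, hzx⟩, hyz, hzy⟩ := exists_map_notMem_span_pair hF hxy hw hx hy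
    obtain ⟨r, e, hgz⟩ := Submodule.mem_span_pair.1 (h z)
    exact (eq_of_map_notMem_span_pair h hxz hzx hgx hgz).trans
      (eq_of_map_notMem_span_pair h hyz hzy hgy hgz).symm
  · rw [LinearIndependent.pair_iff' hx0] at hxy
    push Not at hxy
    obtain ⟨t, rfl⟩ := hxy
    have ht : σ t ≠ 0 := fun h0 => hy (by
      rw [(EmbeddingLike.map_eq_zero_iff).1 h0, zero_smul, f.map_zero]
      exact Submodule.zero_mem _)
    rw [map_smulₛₗ, map_smulₛₗ, RingHom.coe_coe, ← hgx] at hgy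
    by_contra hbd
    refine hx ((Submodule.smul_mem_iff _ (mul_ne_zero ht (sub_ne_zero.2 hbd))).1
      (Submodule.mem_span_singleton.2 ⟨c * t - σ t * a, ?_⟩))
    linear_combination (norm := module) hgy

theorem exists_eq_smul_of_forall_mem_span_pair [Finite F] [FiniteDimensional F V] (hσ : σ ≠ 1)
    (hV : 3 ≤ Module.finrank F V) (h : ∀ x, g x ∈ Submodule.span F {x, f x}) :
    ∃ b : F, g = b • f := by
  obtain ⟨b, hb⟩ : ∃ b : F, ∀ x, ∃ a : F, (g - b • f) x = a • x := by
    by_cases hf : ∀ x, f x ∈ F ∙ x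
    · refine ⟨0, fun x => ?_⟩
      rw [zero_smul, sub_zero]
      have hmem := h x
      rw [Set.pair_comm, Submodule.span_insert_eq_span (hf x)] at hmem
      exact (Submodule.mem_span_singleton.1 hmem).imp fun _ => Eq.symm
    · push Not at hf
      obtain ⟨x, hx⟩ := hf
      obtain ⟨a, b, hgx⟩ := Submodule.mem_span_pair.1 (h x)
      refine ⟨b, fun y => ?_⟩
      obtain ⟨c, d, hgy⟩ := Submodule.mem_span_pair.1 (h y)
      rw [LinearMap.sub_apply, LinearMap.smul_apply, ← hgy]
      by_cases hy : f y ∈ F ∙ y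
      · obtain ⟨e, he⟩ := Submodule.mem_span_singleton.1 hy
        exact ⟨c + (d - b) * e, by rw [← he]; module⟩
      · rw [eq_of_map_notMem_span_singleton (four_le_card hσ) hV h hx hy hgx hgy]
        exact ⟨c, add_sub_cancel_right _ _⟩
  exact ⟨b, sub_eq_zero.1 <|
    eq_zero_of_forall_exists_map_eq_smul (coe_ne_id hσ) (Nat.le_of_succ_le hV) hb⟩

variable {n : ℕ} {X : projectiveSystem n σ → Matrix (Fin (n + 1)) (Fin (n + 1)) F}

theorem isMinimalCode_projectiveCode [Finite F] (hσ : σ ≠ 1) (hX : IsRepresentatives X)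
    (hn : 2 ≤ n) : IsMinimalCode (projectiveCode X) := by
  intro c hc c' hc' hsupp
  obtain ⟨M, rfl⟩ := mem_projectiveCode.1 hc
  obtain ⟨M', rfl⟩ := mem_projectiveCode.1 hc'
  have hsub : arisingHyperplane σ M ⊆ arisingHyperplane σ M' := fun P hP => by
    rw [← codeword_apply_eq_zero_iff hX] at hP ⊢
    exact Function.notMem_support.1 fun h => hsupp h hP
  obtain ⟨b, hb⟩ := exists_eq_smul_of_forall_mem_span_pair hσ
    ((Nat.succ_le_succ hn).trans_eq (Module.finrank_fin_fun F).symm)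
    (twistedMap_mem_span_of_arisingHyperplane_subset hsub)
  have hM' : M' = b • M := twistedMap_injective (σ : F →+* F) <| hb.trans <|
    LinearMap.ext fun x => by
      rw [LinearMap.smul_apply, twistedMap_apply, twistedMap_apply, Matrix.smul_mulVec]
  exact ⟨b, funext fun p => by
    rw [hM', Pi.smul_apply, codeword, codeword, Matrix.mul_smul, Matrix.trace_smul]⟩

end Minimality

/-! ### The plane with an involution -/

section Basis

variable {F : Type*} [Field F] {σ : F →+* F} {V : Type*} [AddCommGroup V] [Module F V]
  [FiniteDimensional F V] {f : V →ₛₗ[σ] V} {r : ℕ} {x : Fin r → V} {l : Fin r → F}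

theorem isEigenbasis_of_finrank_eq (hr : Module.finrank F V = r) (hx : LinearIndependent F x)
    (hl : ∀ i, l i ≠ 0) (hf : ∀ i, f (x i) = l i • x i) : IsEigenbasis f x l where
  linearIndependent := hx
  ne_zero := hl
  map_eq_smul := hf
  mem_span v _ _ _ := by
    rw [hx.span_eq_top_of_card_eq_finrank' ((Fintype.card_fin r).trans hr.symm)]
    trivial

end Basis

section Involution

variable {F : Type*} [Field F] [Finite F] {σ : F ≃+* F}

theorem exists_map_mul_eq_mul_iff (hσ : σ ≠ 1) (hσ2 : σ ^ 2 = 1) {c d : F} (hc : c ≠ 0) :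
    (∃ a ≠ 0, σ a * d = c * a) ↔
      c ^ (Nat.card (fixedField (σ : F →+* F)) + 1) =
        d ^ (Nat.card (fixedField (σ : F →+* F)) + 1) := by
  have hσc : σ c ≠ 0 := (map_ne_zero σ).2 hc
  rw [pow_card_fixedField_succ hσ hσ2, pow_card_fixedField_succ hσ hσ2]
  constructor
  · rintro ⟨a, ha0, ha⟩
    have hσa := congrArg σ ha
    rw [map_mul, map_mul, apply_apply_of_sq_eq_one hσ2] at hσa
    apply mul_left_cancel₀ (mul_ne_zero ha0 ((map_ne_zero σ).2 ha0))
    linear_combination (-σ a * σ c) * ha - σ a * d * hσa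
  · intro hnorm
    obtain ⟨a, ha0, ha⟩ := exists_ne_zero_mul_apply_eq hσ hσ2 (c := d / c) (by
      rw [map_div₀, div_mul_div_comm, ← hnorm, div_self (mul_ne_zero hc hσc)])
    refine ⟨a, ha0, ?_⟩
    rw [div_mul_eq_mul_div, div_eq_iff hc] at ha
    rw [mul_comm, ha, mul_comm]

variable {V : Type*} [AddCommGroup V] [Module F V] [Finite V] {f : V →ₛₗ[(σ : F →+* F)] V} {r : ℕ}
  {x : Fin r → V} {l : Fin r → F}

theorem IsEigenbasis.ncard_eigenpoints_eq_iff (h : IsEigenbasis f x l) (hσ : σ ≠ 1)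
    (hσ2 : σ ^ 2 = 1) (hker : LinearMap.ker f = ⊥) :
    (eigenpoints f).ncard = ∑ i ∈ Finset.range r, Nat.card (fixedField (σ : F →+* F)) ^ i ↔
      ∀ i j, l i ^ (Nat.card (fixedField (σ : F →+* F)) + 1) =
        l j ^ (Nat.card (fixedField (σ : F →+* F)) + 1) := by
  rw [h.ncard_eigenpoints, hker, finrank_bot, Finset.sum_range_zero, zero_add,
    sum_prod_Ioi_eq_iff (fun _ _ => ncard_rescalings_pos)
      fun i j => ncard_rescalings_le (h.ne_zero i) (h.ne_zero j)]
  simp only [ncard_rescalings_eq_card_iff (h.ne_zero _) (h.ne_zero _), RingHom.coe_coe,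
    exists_map_mul_eq_mul_iff hσ hσ2 (h.ne_zero _)]
  refine ⟨fun hlt i j => ?_, fun hall i j _ => hall i j⟩
  rcases lt_trichotomy i j with hij | rfl | hij
  exacts [hlt i j hij, rfl, (hlt j i hij).symm]

theorem ncard_eigenpoints_lt_of_ker_ne_bot (hσ : σ ≠ 1) (hσ2 : σ ^ 2 = 1)
    (hV : Module.finrank F V = 3) (hf : f ≠ 0) (hker : LinearMap.ker f ≠ ⊥) :
    (eigenpoints f).ncard <
      ∑ i ∈ Finset.range 3, Nat.card (fixedField (σ : F →+* F)) ^ i := by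
  have := Module.Finite.of_finite (R := F) (M := V)
  have hs := two_le_card_fixedField (σ : F →+* F)
  have hle := ncard_eigenpoints_le_sum_add_sum f
  have hpos : 0 < Module.finrank F (LinearMap.ker f) := Submodule.one_le_finrank_iff.2 hker
  have hlt : Module.finrank F (LinearMap.ker f) < Module.finrank F V :=
    Submodule.finrank_lt (lt_top_iff_ne_top.2 (mt LinearMap.ker_eq_top.1 hf)).ne
  rw [hV] at hle hlt
  rw [card_eq_card_fixedField_sq hσ hσ2] at hle
  refine hle.trans_lt ?_
  interval_cases Module.finrank F (LinearMap.ker f) <;>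
    simp only [Finset.sum_range_succ, Finset.sum_range_zero] <;> nlinarith

theorem ncard_eigenpoints_le_of_finrank_eq_three (hσ : σ ≠ 1) (hσ2 : σ ^ 2 = 1)
    (hV : Module.finrank F V = 3) (hf : f ≠ 0) :
    (eigenpoints f).ncard ≤
      ∑ i ∈ Finset.range 3, Nat.card (fixedField (σ : F →+* F)) ^ i := by
  by_cases hker : LinearMap.ker f = ⊥
  · have hle := ncard_eigenpoints_le_sum_add_sum f
    rwa [hker, finrank_bot, hV, Finset.sum_range_zero, zero_add] at hle
  · exact (ncard_eigenpoints_lt_of_ker_ne_bot hσ hσ2 hV hf hker).le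

theorem ncard_eigenpoints_eq_iff_exists_linearIndependent (hσ : σ ≠ 1) (hσ2 : σ ^ 2 = 1)
    (hV : Module.finrank F V = 3) (hf : f ≠ 0) :
    (eigenpoints f).ncard =
        ∑ i ∈ Finset.range 3, Nat.card (fixedField (σ : F →+* F)) ^ i ↔
      ∃ l : Fin 3 → F, (∀ i, l i ≠ 0) ∧
        (∀ i j, l i ^ (Nat.card (fixedField (σ : F →+* F)) + 1) =
          l j ^ (Nat.card (fixedField (σ : F →+* F)) + 1)) ∧
        ∃ x : Fin 3 → V, LinearIndependent F x ∧ ∀ i, f (x i) = l i • x i := by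
  have := Module.Finite.of_finite (R := F) (M := V)
  constructor
  · intro hcard
    have hker : LinearMap.ker f = ⊥ := by
      by_contra hker
      exact (ncard_eigenpoints_lt_of_ker_ne_bot hσ hσ2 hV hf hker).ne hcard
    obtain ⟨r, x, l, h⟩ := exists_isEigenbasis f
    have hr := h.add_finrank_ker_le
    rw [hV] at hr
    obtain rfl : r = 3 := by
      refine ((Nat.le_add_right _ _).trans hr).antisymm (not_lt.1 fun hr3 => ?_)
      refine (hcard.symm.le.trans h.ncard_eigenpoints_le).not_gt ?_
      rw [hker, finrank_bot, Finset.sum_range_zero, zero_add]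
      exact Finset.sum_lt_sum_of_subset (Finset.range_mono hr3.le) (Finset.mem_range.2 hr3)
        Finset.notMem_range_self (Nat.pow_pos Nat.card_pos) fun _ _ _ => Nat.zero_le _
    exact ⟨l, h.ne_zero, (h.ncard_eigenpoints_eq_iff hσ hσ2 hker).1 hcard, x,
      h.linearIndependent, h.map_eq_smul⟩
  · rintro ⟨l, hl, hnorm, x, hx, hfx⟩
    have h := isEigenbasis_of_finrank_eq hV hx hl hfx
    have hker : LinearMap.ker f = ⊥ := by
      have hle := h.add_finrank_ker_le
      rw [← Submodule.finrank_eq_zero (R := F)]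
      omega
    exact (h.ncard_eigenpoints_eq_iff hσ hσ2 hker).2 hnorm

end Involution

section LeftEigenvectors

variable {F ι : Type*} [Field F] [Fintype ι] {σ : F →+* F}

theorem mul_eq_diagonal_mul_map_iff [DecidableEq ι] {A B M : Matrix ι ι F} (hAB : A * B = 1)
    (α : ι → F) : A * M = Matrix.diagonal α * A.map σ ↔ M * B.map σ = B * Matrix.diagonal α := by
  have hBA : B * A = 1 := mul_eq_one_comm.1 hAB
  have hAB' : A.map σ * B.map σ = 1 := by
    rw [← Matrix.map_mul, hAB, Matrix.map_one _ (map_zero σ) (map_one σ)]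
  have hBA' : B.map σ * A.map σ = 1 := mul_eq_one_comm.1 hAB'
  constructor
  · intro h
    calc M * B.map σ
      _ = B * (A * M) * B.map σ := by rw [← mul_assoc B, hBA, one_mul]
      _ = B * Matrix.diagonal α * (A.map σ * B.map σ) := by rw [h]; simp only [mul_assoc]
      _ = B * Matrix.diagonal α := by rw [hAB', mul_one]
  · intro h
    calc A * M
      _ = A * (M * B.map σ) * A.map σ := by rw [mul_assoc, mul_assoc, hBA', mul_one]
      _ = (A * B) * Matrix.diagonal α * A.map σ := by rw [h]; simp only [mul_assoc]
      _ = Matrix.diagonal α * A.map σ := by rw [hAB, one_mul]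

/-- If the rows of `A` are independent left eigenvectors, then the columns of `A⁻¹` are
independent right eigenvectors, and conversely. -/
theorem exists_left_eigenvectors_iff (M : Matrix ι ι F) (α : ι → F) :
    (∃ ξ : ι → ι → F, LinearIndependent F ξ ∧ ∀ i, ξ i ᵥ* M = α i • fun k => σ (ξ i k)) ↔
      ∃ x : ι → ι → F, LinearIndependent F x ∧ ∀ i, twistedMap σ M (x i) = α i • x i := by
  classical
  have hrow (A : Matrix ι ι F) :
      A * M = Matrix.diagonal α * A.map σ ↔ ∀ i, A i ᵥ* M = α i • fun k => σ (A i k) := by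
    rw [← Matrix.ext_iff]
    simp only [funext_iff, Matrix.diagonal_mul, Matrix.map_apply, Pi.smul_apply, smul_eq_mul]
    rfl
  have hcol (B : Matrix ι ι F) :
      M * B.map σ = B * Matrix.diagonal α ↔ ∀ i, twistedMap σ M (Bᵀ i) = α i • Bᵀ i := by
    rw [← Matrix.ext_iff, forall_comm]
    simp only [funext_iff, Matrix.mul_diagonal, Pi.smul_apply, smul_eq_mul, mul_comm (α _)]
    rfl
  constructor
  · rintro ⟨ξ, hξ, h⟩
    obtain ⟨B, hB⟩ := (Matrix.linearIndependent_rows_iff_isUnit (A := .of ξ)).1 hξ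
      |>.exists_right_inv
    exact ⟨Bᵀ, Matrix.linearIndependent_cols_iff_isUnit.2 (.of_mul_eq_one _ (mul_eq_one_comm.1 hB)),
      (hcol B).1 ((mul_eq_diagonal_mul_map_iff hB α).1 ((hrow _).2 h))⟩
  · rintro ⟨x, hx, h⟩
    obtain ⟨A, hA⟩ := (Matrix.linearIndependent_cols_iff_isUnit (A := (Matrix.of x)ᵀ)).1 hx
      |>.exists_left_inv
    exact ⟨A, Matrix.linearIndependent_rows_iff_isUnit.2 (.of_mul_eq_one _ hA),
      (hrow A).1 ((mul_eq_diagonal_mul_map_iff hA α).2 ((hcol _).2 h))⟩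

end LeftEigenvectors

section PlaneWeights

variable {F : Type*} [Field F] [Finite F] {σ : F ≃+* F}
  {X : projectiveSystem 2 σ → Matrix (Fin (2 + 1)) (Fin (2 + 1)) F}
  {M : Matrix (Fin (2 + 1)) (Fin (2 + 1)) F}

theorem weight_codeword_add_ncard_eigenpoints (hX : IsRepresentatives X) (hσ : σ ≠ 1)
    (hσ2 : σ ^ 2 = 1) (M : Matrix (Fin (2 + 1)) (Fin (2 + 1)) F) :
    weight (codeword X M) + Nat.card F * (eigenpoints (twistedMap (σ : F →+* F) M)).ncard =
      (Nat.card F ^ 3 - Nat.card (fixedField (σ : F →+* F)) ^ 3) +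
        Nat.card F * ∑ i ∈ Finset.range 3, Nat.card (fixedField (σ : F →+* F)) ^ i := by
  have hcard := ncard_eigenpoints_add_ncard_compl (twistedMap (σ : F →+* F) M)
  have hle : Nat.card (fixedField (σ : F →+* F)) ^ 3 ≤ Nat.card F ^ 3 :=
    Nat.pow_le_pow_left (Finite.card_subtype_le _) 3
  rw [weight_codeword_eq_mul hX]
  rw [card_eq_card_fixedField_sq hσ hσ2] at hcard hle ⊢
  simp only [Finset.sum_range_succ, Finset.sum_range_zero] at hcard ⊢
  zify [hle] at hcard ⊢
  linear_combination (Nat.card (fixedField (σ : F →+* F)) : ℤ) ^ 2 * hcard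

theorem le_weight_codeword_plane (hX : IsRepresentatives X) (hσ : σ ≠ 1) (hσ2 : σ ^ 2 = 1)
    (hM : M ≠ 0) :
    Nat.card F ^ 3 - Nat.card (fixedField (σ : F →+* F)) ^ 3 ≤ weight (codeword X M) := by
  have hweight := weight_codeword_add_ncard_eigenpoints hX hσ hσ2 M
  have hle := Nat.mul_le_mul_left (Nat.card F) <| ncard_eigenpoints_le_of_finrank_eq_three hσ hσ2
    (Module.finrank_fin_fun F) (twistedMap_ne_zero (σ := (σ : F →+* F)) hM)
  omega

theorem weight_codeword_plane_eq_iff (hX : IsRepresentatives X) (hσ : σ ≠ 1) (hσ2 : σ ^ 2 = 1)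
    (hM : M ≠ 0) :
    weight (codeword X M) = Nat.card F ^ 3 - Nat.card (fixedField (σ : F →+* F)) ^ 3 ↔
      ∃ (ξ : Fin 3 → Fin (2 + 1) → F) (α : Fin 3 → F),
        LinearIndependent F ξ ∧ (∀ i, α i ≠ 0) ∧
        (∀ i, ξ i ᵥ* M = α i • fun k => σ (ξ i k)) ∧
        ∀ i j, α i ^ (Nat.card (fixedField (σ : F →+* F)) + 1) =
          α j ^ (Nat.card (fixedField (σ : F →+* F)) + 1) := by
  have hweight := weight_codeword_add_ncard_eigenpoints hX hσ hσ2 M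
  calc weight (codeword X M) = Nat.card F ^ 3 - Nat.card (fixedField (σ : F →+* F)) ^ 3
    _ ↔ (eigenpoints (twistedMap (σ : F →+* F) M)).ncard =
        ∑ i ∈ Finset.range 3, Nat.card (fixedField (σ : F →+* F)) ^ i := by
      refine .trans ?_ (Nat.mul_right_inj (Nat.card_pos (α := F)).ne')
      omega
    _ ↔ _ := by
      rw [ncard_eigenpoints_eq_iff_exists_linearIndependent hσ hσ2 (Module.finrank_fin_fun F)
        (twistedMap_ne_zero hM)]
      simp only [← exists_left_eigenvectors_iff, RingHom.coe_coe]
      exact ⟨fun ⟨α, hα, hnorm, ξ, hξ, h⟩ => ⟨ξ, α, hξ, hα, h, hnorm⟩,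
        fun ⟨ξ, α, hξ, hα, h, hnorm⟩ => ⟨α, hα, hnorm, ξ, hξ, h⟩⟩

theorem isLeast_weights_plane (hX : IsRepresentatives X) (hσ : σ ≠ 1) (hσ2 : σ ^ 2 = 1) :
    IsLeast (weights (projectiveCode X))
      (Nat.card F ^ 3 - Nat.card (fixedField (σ : F →+* F)) ^ 3) := by
  constructor
  · refine (mem_weights_iff hX hσ one_le_two).2 ⟨1, one_ne_zero,
      (weight_codeword_plane_eq_iff hX hσ hσ2 one_ne_zero).2
        ⟨(1 : Matrix (Fin 3) (Fin 3) F), 1, Matrix.linearIndependent_rows_iff_isUnit.2 isUnit_one,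
          fun _ => one_ne_zero, fun i => ?_, fun _ _ => rfl⟩⟩
    ext k
    rw [Matrix.vecMul_one, Pi.one_apply, one_smul, Matrix.one_apply, apply_ite σ, map_one, map_zero]
  · intro w hw
    obtain ⟨M, hM, rfl⟩ := (mem_weights_iff hX hσ one_le_two).1 hw
    exact le_weight_codeword_plane hX hσ hσ2 hM

theorem isMinimumWeightCodeword_plane_iff (hX : IsRepresentatives X) (hσ : σ ≠ 1)
    (hσ2 : σ ^ 2 = 1) (hM : M ≠ 0) :
    IsMinimumWeightCodeword (projectiveCode X) (codeword X M) ↔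
      ∃ (ξ : Fin 3 → Fin (2 + 1) → F) (α : Fin 3 → F),
        LinearIndependent F ξ ∧ (∀ i, α i ≠ 0) ∧
        (∀ i, ξ i ᵥ* M = α i • fun k => σ (ξ i k)) ∧
        ∀ i j, α i ^ (Nat.card (fixedField (σ : F →+* F)) + 1) =
          α j ^ (Nat.card (fixedField (σ : F →+* F)) + 1) := by
  rw [isMinimumWeightCodeword_iff (isLeast_weights_plane hX hσ hσ2) (mem_projectiveCode.2 ⟨M, rfl⟩)
    (mt (codeword_eq_zero_iff hX hσ one_le_two).1 hM), weight_codeword_plane_eq_iff hX hσ hσ2 hM]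

end PlaneWeights

/-! ### The maximum weight -/

section MaximumWeight

variable {F : Type*} [Field F]

theorem twistedMap_diagonal_submatrix {ι : Type*} [Fintype ι] [DecidableEq ι] (σ : F →+* F)
    (ρ : Equiv.Perm ι) (d x : ι → F) (i : ι) :
    twistedMap σ ((Matrix.diagonal d).submatrix id ρ.symm) x i = d i * σ (x (ρ i)) := by
  rw [twistedMap_apply, Matrix.submatrix_mulVec_equiv]
  simp [Matrix.mulVec_diagonal]

variable [Finite F]

theorem isSquare_mul_apply (σ : F ≃+* F) (u : F) : IsSquare (u * σ u) := by
  by_cases hu : IsSquare u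
  · exact hu.mul (hu.map σ)
  · classical
    have := Fintype.ofFinite F
    have hu0 : u ≠ 0 := by
      rintro rfl
      exact hu IsSquare.zero
    have hσu : ¬ IsSquare (σ u) := fun h => hu (by simpa using h.map σ.symm)
    rw [← quadraticChar_one_iff_isSquare (mul_ne_zero hu0 ((map_ne_zero σ).2 hu0)), map_mul,
      quadraticChar_neg_one_iff_not_isSquare.2 hu, quadraticChar_neg_one_iff_not_isSquare.2 hσu,
      neg_mul_neg, one_mul]

theorem eigenpoints_diagonal_submatrix_eq_empty {ι : Type*} [Fintype ι] [DecidableEq ι]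
    (σ : F ≃+* F) {ρ : Equiv.Perm ι} (hρ : Function.Involutive ρ) {d : ι → F}
    (hd : ∀ i, ¬ IsSquare (d i * d (ρ i))) :
    eigenpoints (twistedMap (σ : F →+* F) ((Matrix.diagonal d).submatrix id ρ.symm)) = ∅ := by
  rw [Set.eq_empty_iff_forall_notMem]
  intro p
  induction p with | h x hx =>
  rw [mk_mem_eigenpoints]
  rintro ⟨c, hc⟩
  have hcoord (i : ι) : d i * σ (x (ρ i)) = c * x i := by
    rw [← smul_eq_mul c, ← Pi.smul_apply, ← hc, twistedMap_diagonal_submatrix, RingHom.coe_coe]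
  obtain ⟨i, hi⟩ := Function.ne_iff.1 hx
  have hσi : σ (x i) ≠ 0 := (map_ne_zero σ).2 hi
  have hi' := hcoord (ρ i)
  rw [hρ i] at hi'
  -- Dividing the equation at `i` by the one at `ρ i` eliminates the eigenvalue `c`.
  have heq : d i * d (ρ i) * (x i * σ (x i)) = d i ^ 2 * (x (ρ i) * σ (x (ρ i))) := by
    linear_combination d i * x i * hi' - d i * x (ρ i) * hcoord i
  refine hd i ?_
  rw [eq_div_of_mul_eq (mul_ne_zero hi hσi) heq]
  exact ((IsSquare.sq _).mul (isSquare_mul_apply σ _)).div (isSquare_mul_apply σ _)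

variable {n : ℕ} {σ : F ≃+* F}

theorem exists_eigenpoints_eq_empty (hq : Odd (Nat.card F)) (hn : Odd n) :
    ∃ M : Matrix (Fin (n + 1)) (Fin (n + 1)) F,
      eigenpoints (twistedMap (σ : F →+* F) M) = ∅ := by
  have := Fintype.ofFinite F
  have hchar : ringChar F ≠ 2 := fun h => by
    rw [Nat.card_eq_fintype_card, Nat.odd_iff, FiniteField.even_card_of_char_two h] at hq
    exact zero_ne_one hq
  obtain ⟨a, ha⟩ := FiniteField.exists_nonsquare hchar
  refine ⟨_, eigenpoints_diagonal_submatrix_eq_empty σ (ρ := Fin.revPerm) Fin.rev_rev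
    (d := fun i => if i < i.rev then a else 1) fun i => ?_⟩
  have hrev : i < i.rev ∨ i.rev < i := by
    obtain ⟨k, rfl⟩ := hn
    simp only [Fin.lt_def, Fin.val_rev]
    omega
  rcases hrev with h | h
  · simpa [h, h.not_gt] using ha
  · simpa [h, h.not_gt] using ha

theorem isGreatest_weights_of_odd
    {X : projectiveSystem n σ → Matrix (Fin (n + 1)) (Fin (n + 1)) F} (hX : IsRepresentatives X)
    (hσ : σ ≠ 1) (hq : Odd (Nat.card F)) (hn : Odd n) :
    IsGreatest (weights (projectiveCode X))
      (Nat.card F ^ (n - 1) * (Nat.card F ^ (n + 1) - 1) / (Nat.card F - 1)) := by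
  have hsum : Nat.card F ^ (n - 1) * (Nat.card F ^ (n + 1) - 1) / (Nat.card F - 1) =
      Nat.card F ^ (n - 1) * ∑ i ∈ Finset.range (n + 1), Nat.card F ^ i := by
    rw [Nat.geomSum_eq Finite.one_lt_card, Nat.mul_div_assoc]
    simpa only [one_pow] using Nat.sub_dvd_pow_sub_pow (Nat.card F) 1 (n + 1)
  rw [hsum]
  constructor
  · obtain ⟨M, hM⟩ := exists_eigenpoints_eq_empty (σ := σ) hq hn
    have hM0 : M ≠ 0 := by
      rintro rfl
      obtain ⟨p⟩ : Nonempty (ℙ F (Fin (n + 1) → F)) := inferInstance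
      refine Set.eq_empty_iff_forall_notMem.1 hM p (mem_eigenpoints.2 ⟨0, ?_⟩)
      rw [twistedMap_zero, LinearMap.zero_apply, zero_smul]
    refine (mem_weights_iff hX hσ hn.pos).2 ⟨M, hM0, ?_⟩
    rw [weight_codeword_eq_mul hX,
      ← ncard_eigenpoints_add_ncard_compl (twistedMap (σ : F →+* F) M), hM, Set.ncard_empty,
      zero_add]
  · intro w hw
    obtain ⟨M, -, rfl⟩ := (mem_weights_iff hX hσ hn.pos).1 hw
    rw [weight_codeword_eq_mul hX,
      ← ncard_eigenpoints_add_ncard_compl (twistedMap (σ : F →+* F) M)]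
    exact Nat.mul_le_mul_left _ (Nat.le_add_left _ _)

end MaximumWeight

/-! ### Semi-standard spreads -/

section Spread

variable {F : Type*} [Field F] [Finite F]

theorem exists_map_eq_smul_of_forall_map_map {V : Type*} [AddCommGroup V] [Module F V]
    [Nontrivial V] {τ : F ≃+* F} (hτ : τ ≠ 1) {f : V →ₛₗ[(τ : F →+* F)] V}
    (hf : Function.Injective f) (h : ∀ x, ∃ c : F, f (f x) = c • x) :
    ∃ x ≠ 0, ∃ a : F, f x = a • x := by
  obtain ⟨x, hx⟩ := exists_ne (0 : V)
  by_cases! hfx : ∃ a : F, f x = a • x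
  · exact ⟨x, hx, hfx⟩
  have hli : LinearIndependent F ![x, f x] :=
    (LinearIndependent.pair_iff' hx).2 fun a ha => hfx a ha.symm
  obtain ⟨c, hc⟩ := h x
  have hc0 : c ≠ 0 := by
    rintro rfl
    rw [zero_smul, map_eq_zero_iff f hf, map_eq_zero_iff f hf] at hc
    exact hx hc
  have hcomm (k : F) : τ (τ k) * τ c = c * k := by
    obtain ⟨e, he⟩ := h (x + k • f x)
    simp only [map_add, map_smulₛₗ, hc, RingHom.coe_coe, smul_smul, smul_add] at he
    obtain ⟨h1, h2⟩ := hli.eq_of_pair he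
    rw [← map_mul, h2, h1, mul_comm]
  have hτc : τ c = c := by simpa only [map_one, one_mul, mul_one] using hcomm 1
  have hτ2 : τ ^ 2 = 1 := RingEquiv.ext fun k => by
    refine mul_right_cancel₀ hc0 ?_
    rw [pow_two, RingAut.mul_apply, RingAut.one_apply, mul_comm k, ← hcomm k, hτc]
  obtain ⟨m, hm⟩ := exists_mul_apply_eq hτ hτ2 (c := c⁻¹) (by rw [map_inv₀, hτc])
  -- `x ↦ m • f x` is an involution, so it fixes `x + m • f x`.
  refine ⟨x + m • f x, fun h0 => ?_, τ m * c, ?_⟩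
  · exact one_ne_zero (LinearIndependent.pair_iff.1 hli 1 m (by rwa [one_smul])).1
  · rw [map_add, map_smulₛₗ, hc, RingHom.coe_coe, smul_add, smul_smul, smul_smul, mul_right_comm,
      mul_comm (τ m) m, hm, inv_mul_cancel₀ hc0, one_smul, add_comm]

theorem not_isSemiStandardSpreadType {n : ℕ} (H : Set (PHPoint F n)) :
    ¬ IsSemiStandardSpreadType H := by
  rintro ⟨τ, f, hf, hτ, hinv, hfree, -⟩
  obtain ⟨x, hx, a, ha⟩ := exists_map_eq_smul_of_forall_map_map hτ hf fun x => by
    rcases eq_or_ne x 0 with rfl | hx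
    · exact ⟨0, by rw [map_zero, map_zero, smul_zero]⟩
    · have hmap := hinv (Projectivization.mk F x hx)
      rw [Projectivization.map_mk, Projectivization.map_mk, Projectivization.mk_eq_mk_iff'] at hmap
      obtain ⟨c, hc⟩ := hmap
      exact ⟨c, hc.symm⟩
  refine hfree (Projectivization.mk F x hx) ?_
  rw [Projectivization.map_mk, Projectivization.mk_eq_mk_iff']
  exact ⟨a, ha.symm⟩

end Spread

end TwistedCode

open TwistedCode in
theorem theorem2 {F : Type*} [Field F] [Finite F] (n : ℕ) (σ : F ≃+* F) (hσ : σ ≠ 1)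
    (X : projectiveSystem n σ → Matrix (Fin (n + 1)) (Fin (n + 1)) F) (hX : IsRepresentatives X)
    (q s : ℕ) (hq : q = Nat.card F) (hs : s = Nat.card {a : F // σ a = a}) :
    -- the code is minimal
    (2 ≤ n → IsMinimalCode (projectiveCode X)) ∧
    -- the plane case with an involutory automorphism
    (n = 2 → σ ^ 2 = 1 →
      q = s ^ 2 ∧
      IsLeast (weights (projectiveCode X)) (q ^ 3 - s ^ 3) ∧
      ∀ M : Matrix (Fin (n + 1)) (Fin (n + 1)) F, M ≠ 0 →
        (IsMinimumWeightCodeword (projectiveCode X) (codeword X M) ↔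
          ∃ (ξ : Fin 3 → Fin (n + 1) → F) (α : Fin 3 → F),
            LinearIndependent F ξ ∧ (∀ i, α i ≠ 0) ∧
            (∀ i, ξ i ᵥ* M = α i • fun k => σ (ξ i k)) ∧
            ∀ i j, α i ^ (s + 1) = α j ^ (s + 1))) ∧
    -- the remaining cases
    (2 ≤ n → 2 < n ∨ σ ^ 2 ≠ 1 →
      IsLeast (weights (projectiveCode X)) (q ^ (2 * n - 1) - q ^ (n - 1)) ∧
      IsLeast (nonMinimumWeights (projectiveCode X)) (q ^ (2 * n - 1)) ∧
      (∀ M : Matrix (Fin (n + 1)) (Fin (n + 1)) F, M ≠ 0 →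
        (IsMinimumWeightCodeword (projectiveCode X) (codeword X M) ↔
          IsQuasiSingular (arisingHyperplane σ M) ∧ ¬ IsSingular (arisingHyperplane σ M)) ∧
        (IsSecondLowestWeightCodeword (projectiveCode X) (codeword X M) ↔
          IsSingular (arisingHyperplane σ M))) ∧
      (∀ H : Set (PHPoint F n), IsQuasiSingular H →
        ∃ M : Matrix (Fin (n + 1)) (Fin (n + 1)) F, M ≠ 0 ∧ H = arisingHyperplane σ M)) ∧
    -- maximum weight codewords
    (Odd q → Odd n →
      IsGreatest (weights (projectiveCode X)) (q ^ (n - 1) * (q ^ (n + 1) - 1) / (q - 1))) ∧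
    (∀ H : Set (PHPoint F n), IsSemiStandardSpreadType H →
      (∀ M : Matrix (Fin (n + 1)) (Fin (n + 1)) F, M ≠ 0 → H = arisingHyperplane σ M →
        σ ^ 2 = 1 ∧ Odd n ∧
        IsMaximumWeightCodeword (projectiveCode X) (codeword X M) ∧
        weight (codeword X M) = q ^ (n - 1) * (q ^ (n + 1) - 1) / (q - 1)) ∧
      (σ ^ 2 = 1 →
        ∃ M : Matrix (Fin (n + 1)) (Fin (n + 1)) F, M ≠ 0 ∧ H = arisingHyperplane σ M)) := by
  subst hq hs
  refine ⟨isMinimalCode_projectiveCode hσ hX, ?_, fun hn h => ?_,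
    isGreatest_weights_of_odd hX hσ, fun H hH => absurd hH (not_isSemiStandardSpreadType H)⟩
  · rintro rfl hσ2
    exact ⟨card_eq_card_fixedField_sq hσ hσ2, isLeast_weights_plane hX hσ hσ2,
      fun M hM => isMinimumWeightCodeword_plane_iff hX hσ hσ2 hM⟩
  · exact ⟨isLeast_weights hX hσ hn h, isLeast_nonMinimumWeights hX hσ hn h,
      fun M hM => ⟨isMinimumWeightCodeword_iff_isQuasiSingular hX hσ hn h hM,
        isSecondLowestWeightCodeword_iff_isSingular hX hσ hn h hM⟩,
      fun H hH => hH.exists_eq_arisingHyperplane hn σ⟩
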